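/- Let $A\in\mathbb R^{n\times n}$ and $0\ne \mathbf v\in\mathbb R^n$, and suppose that the numerical range $W(A)=\{(A\mathbf x,\mathbf x)/(\mathbf x,\mathbf x):\mathbf 0\ne\mathbf x\in\mathbb C^n\}$ is contained in the sector $\{z\in\mathbb C: |\arg(z-a)|\le\vartheta\}$ (vertex $a$ included) for some $a\ge 0$ and $0\le\vartheta\le\pi/2$. Let $\|\cdot\|_2$ be the Euclidean norm. Let $\varphi_0(z)=e^z$ and $\varphi_\ell(z)=\frac1{(\ell-1)!}\int_0^1 e^{(1-\theta)z}\theta^{\ell-1}\,d\theta$ for $\ell\ge1$, and use the same notation for the corresponding matrix functions. Run the Arnoldi process for $A$ with starting vector $\mathbf v$: $\mathbf v_1=\mathbf v/\|\mathbf v\|_2$, and for $j=1,2,\dots$ put $h_{i,j}=(A\mathbf v_j,\mathbf v_i)$ for $i\le j$, $\mathbf w_j=A\mathbf v_j-\sum_{i\le j}h_{i,j}\mathbf v_i$, $h_{j+1,j}=\|\mathbf w_j\|_2$, $\mathbf v_{j+1}=\mathbf w_j/h_{j+1,j}$, and $h_{i,j}=0$ for $i>j+1$. Assume that it does not break down before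 step $k$, that is, $h_{j+1,j}\ne0$ for $1\le j\le k-1$. Put $V_k=[\mathbf v_1,\dots,\mathbf v_k]$, $H_k=(h_{i,j})_{1\le i,j\le k}$, $\beta=\|\mathbf v\|_2$, and let $\mathbf e_1,\mathbf e_k$ be the first and last columns of the $k\times k$ identity matrix. For $\ell\in\{0,1,2,\dots\}$ and $t>0$ let $\mathbf y(t)=\varphi_\ell(-tA)\mathbf v$, let $\mathbf y_{\ell,k}(t)=V_k\varphi_\ell(-tH_k)\beta\mathbf e_1$ be its Arnoldi approximation, let $\mathbf e_{\ell,k}(t)=\mathbf y(t)-\mathbf y_{\ell,k}(t)$ be the error, and let the residual be $\mathbf r_{0,k}(t)=-A\mathbf y_{0,k}(t)-\mathbf y_{0,k}'(t)$ and, for $\ell\ge1$, $$\mathbf r_{\ell,k}(t)=-A\mathbf y_{\ell,k}(t)-\frac{\ell}{t}\mathbf y_{\ell,k}(t)+\frac{1}{t(\ell-1)!}\mathbf v-\mathbf y_{\ell,k}'(t).$$ Let $\mu_j=a_j+\mathbf i b_j$ $(1\le j\le k)$ be the eigenvalues of $H_k$, counted with algebraic multiplicity and ordered so that $\mu_1,\dots,\mu_{k_1}$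 are the real ones and $\mu_{k_1+1},\dots,\mu_k$ the non-real ones. Let $\varepsilon>0$ and put $$r_j=\big((\varepsilon+a_j)^2+b_j^2\big)^{1/2},\qquad R=\max_{1\le j\le k}r_j,\qquad \omega_k(\varepsilon)=\prod_{j=1}^k\big(r_j(\varepsilon+a_j)\big)^{1/2}.$$ If $k+k_1\ge4$ and $\mathbf e_k^{\rm H}\varphi_\ell(-tH_k)\mathbf e_1\ne0$, then $$\|\mathbf e_{\ell,k}(t)\|_2\le c_{\ell,k}\cdot C_k\cdot\|\mathbf r_{\ell,k}(t)\|_2,$$ where $$c_{\ell,k}=\frac{\exp(t\varepsilon)}{\pi(t\varepsilon)^\ell\,\omega_k(\varepsilon)(\varepsilon+a)}\cdot\frac{\prod_{j=1}^{k-1}h_{j+1,j}}{|\mathbf e_k^{\rm H}\varphi_\ell(-tH_k)\mathbf e_1|},$$ $$C_k=\frac{\sqrt\pi}{2\sqrt{S_1}}+\exp(-\varepsilon^2S_2)(R-\varepsilon)+\Big(\frac{\varepsilon}{\sqrt{\varepsilon^2+R^2}}\Big)^{\ell}\frac{\pi R}{2^{\frac{k+k_1}{4}+1}},$$ $$S_1=\frac{\ell}{4\varepsilon^2}+\frac12\sum_{j=1}^{k_1}\frac1{r_j^2+\varepsilon^2}+\frac14\sum_{j=k_1+1}^{k}\frac1{r_j^2+\varepsilon^2},$$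 $$S_2=\frac{\ell}{2(\varepsilon^2+R^2)}+\frac12\sum_{j=1}^{k_1}\frac1{r_j^2+R^2}+\frac14\sum_{j=k_1+1}^{k}\frac1{r_j^2+R^2}.$$ -/

import Mathlib

open scoped Matrix

noncomputable section

namespace PhiArnoldi

/-- The action of a real matrix on Euclidean space: the vector `M x`. -/
def act {m n : ℕ} (M : Matrix (Fin m) (Fin n) ℝ) (x : EuclideanSpace ℝ (Fin n)) :
    EuclideanSpace ℝ (Fin m) :=
  WithLp.toLp 2 (M *ᵥ x.ofLp)

/-- The matrix functions `φ_ℓ`: `φ_0(M) = exp M` and, for `ℓ ≥ 1`,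
`φ_ℓ(M) = (1 / (ℓ - 1)!) ∫_0^1 exp((1 - θ) M) θ^(ℓ - 1) dθ` (the integral is taken entrywise). -/
def phi {m : ℕ} : ℕ → Matrix (Fin m) (Fin m) ℝ → Matrix (Fin m) (Fin m) ℝ
  | 0, M => NormedSpace.exp M
  | l + 1, M => Matrix.of fun i j =>
      (1 / (l.factorial : ℝ)) *
        ∫ θ in (0 : ℝ)..1, (NormedSpace.exp ((1 - θ) • M)) i j * θ ^ l

/-- The numerical range `{(A x, x) / (x, x) : 0 ≠ x ∈ ℂ^n}`. -/
def numericalRange {n : ℕ} (A : Matrix (Fin n) (Fin n) ℂ) : Set ℂ :=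
  {z | ∃ x : Fin n → ℂ, x ≠ 0 ∧ z = (star x ⬝ᵥ (A *ᵥ x)) / (star x ⬝ᵥ x)}

/-- The closed sector with vertex `a` and half-opening angle `ϑ` (the vertex is included,
since `Complex.arg 0 = 0`). -/
def sector (ϑ a : ℝ) : Set ℂ :=
  {z | |Complex.arg (z - (a : ℂ))| ≤ ϑ}

section Arnoldi

variable {n : ℕ} (A : Matrix (Fin n) (Fin n) ℝ) (v : EuclideanSpace ℝ (Fin n))

/-- The vectors produced by the Arnoldi process started at `v`, indexed from `0`: the first is
`v / ‖v‖`, and each next one is the normalization of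
`A v_j - ∑_{i ≤ j} (v_i, A v_j) v_i`. -/
def arnoldiVec : ℕ → EuclideanSpace ℝ (Fin n)
  | 0 => ‖v‖⁻¹ • v
  | j + 1 =>
      ‖act A (arnoldiVec j) - ∑ i : Fin (j + 1),
          (inner ℝ (arnoldiVec i.val) (act A (arnoldiVec j)) : ℝ) • arnoldiVec i.val‖⁻¹ •
        (act A (arnoldiVec j) - ∑ i : Fin (j + 1),
          (inner ℝ (arnoldiVec i.val) (act A (arnoldiVec j)) : ℝ) • arnoldiVec i.val)
termination_by j => j
decreasing_by all_goals first | exact Nat.lt_succ_self _ | exact i.isLt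

/-- The vector `A v_j - ∑_{i ≤ j} (v_i, A v_j) v_i` whose normalization is `v_{j+1}`. -/
def arnoldiRemainder (j : ℕ) : EuclideanSpace ℝ (Fin n) :=
  act A (arnoldiVec A v j) - ∑ i ∈ Finset.range (j + 1),
    (inner ℝ (arnoldiVec A v i) (act A (arnoldiVec A v j)) : ℝ) • arnoldiVec A v i

/-- The coefficients of the Arnoldi process (indices from `0`): `h i j = (v_i, A v_j)` for
`i ≤ j`, `h (j+1) j` is the norm of the orthogonalized vector, and `h i j = 0` below that. -/
def arnoldiCoeff (i j : ℕ) : ℝ :=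
  if i ≤ j then inner ℝ (arnoldiVec A v i) (act A (arnoldiVec A v j))
  else if i = j + 1 then ‖arnoldiRemainder A v j‖
  else 0

/-- The `n × k` matrix `V_k` whose columns are the first `k` Arnoldi vectors. -/
def arnoldiV (k : ℕ) : Matrix (Fin n) (Fin k) ℝ :=
  Matrix.of fun i j => arnoldiVec A v j.val i

/-- The `k × k` upper Hessenberg matrix `H_k` of the Arnoldi process. -/
def arnoldiH (k : ℕ) : Matrix (Fin k) (Fin k) ℝ :=
  Matrix.of fun i j => arnoldiCoeff A v i.val j.val

/-- The first column of the `k × k` identity matrix. -/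
def unitFirst (k : ℕ) : EuclideanSpace ℝ (Fin k) :=
  WithLp.toLp 2 fun i => if i.val = 0 then 1 else 0

/-- The `k`-th (last) column of the `k × k` identity matrix. -/
def unitLast (k : ℕ) : EuclideanSpace ℝ (Fin k) :=
  WithLp.toLp 2 fun i => if i.val + 1 = k then 1 else 0

/-- The exact vector `y(t) = φ_ℓ(-t A) v`. -/
def exact (ℓ : ℕ) (t : ℝ) : EuclideanSpace ℝ (Fin n) :=
  act (phi ℓ ((-t) • A)) v

/-- The Arnoldi approximation `y_{ℓ,k}(t) = V_k φ_ℓ(-t H_k) β e_1`, with `β = ‖v‖`. -/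
def approx (ℓ k : ℕ) (t : ℝ) : EuclideanSpace ℝ (Fin n) :=
  act (arnoldiV A v k) (act (phi ℓ ((-t) • arnoldiH A v k)) (‖v‖ • unitFirst k))

/-- The error `e_{ℓ,k}(t) = y(t) - y_{ℓ,k}(t)`. -/
def err (ℓ k : ℕ) (t : ℝ) : EuclideanSpace ℝ (Fin n) :=
  exact A v ℓ t - approx A v ℓ k t

/-- The residual: `-A y_{0,k}(t) - y_{0,k}'(t)` for `ℓ = 0`, and
`-A y_{ℓ,k}(t) - (ℓ / t) y_{ℓ,k}(t) + v / (t (ℓ - 1)!) - y_{ℓ,k}'(t)` for `ℓ ≥ 1`. -/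
def residual : ℕ → ℕ → ℝ → EuclideanSpace ℝ (Fin n)
  | 0, k, t => -act A (approx A v 0 k t) - deriv (approx A v 0 k) t
  | l + 1, k, t =>
      -act A (approx A v (l + 1) k t) - (((l + 1 : ℕ) : ℝ) / t) • approx A v (l + 1) k t
        + (1 / (t * (l.factorial : ℝ))) • v - deriv (approx A v (l + 1) k) t

/-- The scalar `e_k^H φ_ℓ(-t H_k) e_1`. -/
def phiCorner (ℓ k : ℕ) (t : ℝ) : ℝ :=
  inner ℝ (unitLast k) (act (phi ℓ ((-t) • arnoldiH A v k)) (unitFirst k))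

end Arnoldi

/-- `μ` lists the eigenvalues of the real matrix `H` with algebraic multiplicity, in such an
order that the first `k₁` of them are the real ones and the others are non-real. -/
structure IsEigenvalueList {k : ℕ} (H : Matrix (Fin k) (Fin k) ℝ) (k₁ : ℕ) (μ : Fin k → ℂ) :
    Prop where
  roots_eq : (H.map (fun x : ℝ => (x : ℂ))).charpoly.roots = Finset.univ.val.map μ
  le : k₁ ≤ k
  real_iff : ∀ j : Fin k, (μ j).im = 0 ↔ j.val < k₁

section Constants

variable {k : ℕ} (μ : Fin k → ℂ) (k₁ ℓ : ℕ) (ε : ℝ)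

/-- `r_j = ((ε + a_j)² + b_j²)^(1/2)` where `μ_j = a_j + i b_j`. -/
def rad (j : Fin k) : ℝ :=
  Real.sqrt ((ε + (μ j).re) ^ 2 + (μ j).im ^ 2)

/-- `R = max_j r_j`. -/
def radMax : ℝ := ⨆ j : Fin k, rad μ ε j

/-- `ω_k(ε) = ∏_j (r_j (ε + a_j))^(1/2)`. -/
def omega : ℝ := ∏ j : Fin k, Real.sqrt (rad μ ε j * (ε + (μ j).re))

/-- The constant `S_1`. -/
def S₁ : ℝ :=
  (ℓ : ℝ) / (4 * ε ^ 2)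
    + 1 / 2 * ∑ j : Fin k with j.val < k₁, 1 / (rad μ ε j ^ 2 + ε ^ 2)
    + 1 / 4 * ∑ j : Fin k with k₁ ≤ j.val, 1 / (rad μ ε j ^ 2 + ε ^ 2)

/-- The constant `S_2`. -/
def S₂ : ℝ :=
  (ℓ : ℝ) / (2 * (ε ^ 2 + radMax μ ε ^ 2))
    + 1 / 2 * ∑ j : Fin k with j.val < k₁, 1 / (rad μ ε j ^ 2 + radMax μ ε ^ 2)
    + 1 / 4 * ∑ j : Fin k with k₁ ≤ j.val, 1 / (rad μ ε j ^ 2 + radMax μ ε ^ 2)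

/-- The constant `C_k`. -/
def bigC : ℝ :=
  Real.sqrt Real.pi / (2 * Real.sqrt (S₁ μ k₁ ℓ ε))
    + Real.exp (-ε ^ 2 * S₂ μ k₁ ℓ ε) * (radMax μ ε - ε)
    + (ε / Real.sqrt (ε ^ 2 + radMax μ ε ^ 2)) ^ ℓ
        * (Real.pi * radMax μ ε / (2 : ℝ) ^ (((k : ℝ) + (k₁ : ℝ)) / 4 + 1))

end Constants

/-- The constant `c_{ℓ,k}`, in which `h_{j+1,j}` are the subdiagonal entries of `H_k`. -/
def smallC {n : ℕ} (A : Matrix (Fin n) (Fin n) ℝ) (v : EuclideanSpace ℝ (Fin n)) {k : ℕ}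
    (μ : Fin k → ℂ) (a ε : ℝ) (ℓ : ℕ) (t : ℝ) : ℝ :=
  Real.exp (t * ε) / (Real.pi * (t * ε) ^ ℓ * omega μ ε * (ε + a))
    * ((∏ j ∈ Finset.range (k - 1), arnoldiCoeff A v (j + 1) j) / |phiCorner A v ℓ k t|)

end PhiArnoldi

end

/-! The factor `t ^ ℓ` turns `φ_ℓ(-tM)x` into a solution of `u' = -Mu + f x` with `f = 0` for `ℓ =
0` and `f = t^(ℓ-1)/(ℓ-1)!` otherwise (`hasDerivAt_act_flow`). With `w` the last unnormalized
Arnoldi vector and `AV = VH + w e_kᵀ` (`arnoldi_relation`), the scaled error `E = t^ℓ e_{ℓ,k}`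
satisfies `E' = -AE - g(t) w`, `E(0) = 0`, where `g = e_kᵀ t^ℓ φ_ℓ(-tH) β e_1`. The residual is the
same term unscaled, `-β (e_kᵀ φ_ℓ(-tH) e_1) w` (`residual_eq`), which is how `‖w‖` is traded for the
residual norm.

A Laplace transform gives `(z + A) Ê = -ĝ(z) w`. The numerical range lies in `Re ≥ a`, so `‖Ê‖ ≤ |ĝ|
‖w‖ / (Re z + a)` (`norm_smul_add_cact_ge`). Since `H` is Hessenberg, Cramer's rule gives `|ĝ(z)| =
β |z|^(-ℓ) ∏ h_{j+1,j} / |det(z + H)|` (`det_mul_norm_laplace_flow_last`).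

Laplace inversion on `Re z = ε` (`norm_le_integral_laplace`) leaves a scalar integral. As `H` is
real, `|det(z + H)|² = |det(z + H) det(z̄ + H)|`, which bounds the determinant below by `ω_k(ε) ∏ (1
+ y²/r_j²)^(1/2)` on the line. Splitting the integral at `ε` and `R` produces the three terms of
`C_k` (`integral_kernel_le`). -/

noncomputable section

namespace PhiArnoldi

/-! ### Laplace transform of vector-valued functions -/

section Laplace

open MeasureTheory Set Filter Topology Asymptotics

variable {E : Type*} [NormedAddCommGroup E]

/-- Functions that are `O(exp (δ t))` at infinity for every `δ > 0`. -/
def SubExp (u : ℝ → E) : Prop :=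
  ∀ δ : ℝ, 0 < δ → u =O[atTop] fun t => Real.exp (δ * t)

lemma SubExp.of_pow_bound {u : ℝ → E} {C : ℝ} {m : ℕ} (h : ∀ t : ℝ, 0 ≤ t → ‖u t‖ ≤ C * t ^ m) :
    SubExp u := by
  intro δ hδ
  refine IsBigO.trans (g := fun t : ℝ => t ^ m) ?_ (isLittleO_pow_exp_pos_mul_atTop m hδ).isBigO
  refine IsBigO.of_bound C ?_
  filter_upwards [eventually_ge_atTop 0] with t ht
  rw [Real.norm_of_nonneg (by positivity)]
  exact h t ht

variable [NormedSpace ℂ E]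

/-- The (one-sided) Laplace transform of a vector-valued function. -/
def laplace (u : ℝ → E) (z : ℂ) : E :=
  ∫ t in Ioi (0 : ℝ), Complex.exp (-z * t) • u t

lemma SubExp.clm {F : Type*} [NormedAddCommGroup F] [NormedSpace ℂ F] {u : ℝ → E}
    (hu : SubExp u) (T : E →L[ℂ] F) : SubExp (fun t => T (u t)) :=
  fun δ hδ => (T.isBigO_comp u atTop).trans (hu δ hδ)

lemma norm_exp_smul (z : ℂ) (t : ℝ) (x : E) :
    ‖Complex.exp (-z * t) • x‖ = Real.exp (-z.re * t) * ‖x‖ := by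
  rw [norm_smul, Complex.norm_exp]
  simp

lemma SubExp.isBigO_exp_smul {u : ℝ → E} (hu : SubExp u) {z : ℂ} (hz : 0 < z.re) :
    (fun t : ℝ => Complex.exp (-z * t) • u t) =O[atTop] fun t => Real.exp (-(z.re / 2) * t) := by
  have h := hu (z.re / 2) (by positivity)
  have h1 : (fun t : ℝ => Complex.exp (-z * t)) =O[atTop] fun t : ℝ => Real.exp (-z.re * t) := by
    refine IsBigO.of_bound 1 (Eventually.of_forall fun t => ?_)
    rw [Complex.norm_exp, Real.norm_of_nonneg (Real.exp_pos _).le]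
    simp
  refine (h1.smul h).congr_right fun t => ?_
  rw [smul_eq_mul, ← Real.exp_add]
  ring_nf

lemma SubExp.integrableOn {u : ℝ → E} (hc : Continuous u) (hu : SubExp u) {z : ℂ}
    (hz : 0 < z.re) : IntegrableOn (fun t : ℝ => Complex.exp (-z * t) • u t) (Ioi 0) := by
  have hcont : Continuous (fun t : ℝ => Complex.exp (-z * t) • u t) := by fun_prop
  rw [IntegrableOn, ← integrable_norm_iff hcont.aestronglyMeasurable]
  exact integrable_of_isBigO_exp_neg (b := z.re / 2) (by positivity)
    hcont.norm.continuousOn (hu.isBigO_exp_smul hz).norm_left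

lemma SubExp.tendsto_zero {u : ℝ → E} (hu : SubExp u) {z : ℂ} (hz : 0 < z.re) :
    Tendsto (fun t : ℝ => Complex.exp (-z * t) • u t) atTop (𝓝 0) := by
  refine (hu.isBigO_exp_smul hz).trans_tendsto ?_
  refine Real.tendsto_exp_atBot.comp ?_
  exact tendsto_id.const_mul_atTop_of_neg (by linarith)

/-- Supplies the measurability on the line `Re z = ε` needed to infer integrability from a pointwise
majorant. -/
lemma continuous_laplace_line {u : ℝ → E} (hc : Continuous u) (hu : SubExp u) {ε : ℝ}
    (hε : 0 < ε) : Continuous (fun y : ℝ => laplace u (ε + y * Complex.I)) := by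
  refine continuous_of_dominated (bound := fun s : ℝ => ‖Complex.exp (-(ε : ℂ) * s) • u s‖)
    (fun y => Continuous.aestronglyMeasurable (by fun_prop)) (fun y => ?_)
    (hu.integrableOn hc (z := (ε : ℂ)) (by simpa using hε)).norm ?_
  · refine Eventually.of_forall fun s => ?_
    rw [norm_exp_smul, norm_exp_smul]
    simp
  · exact Eventually.of_forall fun s => by fun_prop

variable [CompleteSpace E]

/-- The Laplace transform turns the equation `u' = -T u + f` into
`z û + T û = u(0) + f̂`. -/
lemma laplace_of_ode {u f : ℝ → E} (T : E →L[ℂ] E)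
    (hd : ∀ t, HasDerivAt u (-(T (u t)) + f t) t) (hfc : Continuous f)
    (hu : SubExp u) (hf : SubExp f) {z : ℂ} (hz : 0 < z.re) :
    z • laplace u z + T (laplace u z) = u 0 + laplace f z := by
  have hc : Continuous u := continuous_iff_continuousAt.2 fun t => (hd t).continuousAt
  have hTi : IntegrableOn (fun t : ℝ => Complex.exp (-z * t) • T (u t)) (Ioi 0) :=
    (hu.clm T).integrableOn (T.continuous.comp hc) hz
  have hui := hu.integrableOn hc hz
  have hfi := hf.integrableOn hfc hz
  have hexp (t : ℝ) : HasDerivAt (fun t : ℝ => Complex.exp (-z * t))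
      (Complex.exp (-z * t) * (-z)) t := by
    have h := ((hasDerivAt_id (t : ℂ)).const_mul (-z)).cexp.comp_ofReal
    simpa using h
  have hder (t : ℝ) : HasDerivAt (fun t : ℝ => Complex.exp (-z * t) • u t)
      (-(z • (Complex.exp (-z * t) • u t)) - Complex.exp (-z * t) • T (u t)
        + Complex.exp (-z * t) • f t) t := by
    have h := (hexp t).smul (hd t)
    refine HasDerivAt.congr_deriv h ?_
    rw [smul_add, smul_neg, smul_smul, mul_comm z, mul_neg, neg_smul]
    abel
  have hzi : IntegrableOn (fun t : ℝ => -(z • (Complex.exp (-z * t) • u t))) (Ioi 0) :=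
    (hui.smul z).neg
  have hzT : IntegrableOn (fun t : ℝ => -(z • (Complex.exp (-z * t) • u t))
      - Complex.exp (-z * t) • T (u t)) (Ioi 0) := hzi.sub hTi
  -- The fundamental theorem of calculus for `exp(-zt) u(t)` on the half-line; the boundary term at
  -- infinity vanishes by subexponential growth.
  have h := integral_Ioi_of_hasDerivAt_of_tendsto' (a := (0 : ℝ)) (fun t _ => hder t)
    (hzT.add hfi) (hu.tendsto_zero hz)
  rw [integral_add hzT hfi, integral_sub hzi hTi, integral_neg, integral_smul] at h
  have hT : ∫ t in Ioi (0 : ℝ), Complex.exp (-z * t) • T (u t) = T (laplace u z) := by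
    rw [laplace, ← T.integral_comp_comm hui]
    simp
  rw [hT] at h
  simp only [Complex.ofReal_zero, mul_zero, Complex.exp_zero, one_smul, zero_sub] at h
  change -(z • laplace u z) - T (laplace u z) + laplace f z = -u 0 at h
  have h2 : u 0 = z • laplace u z + T (laplace u z) - laplace f z := by
    rw [← neg_neg (u 0), ← h]
    abel
  rw [h2]
  abel

lemma laplace_clm {F : Type*} [NormedAddCommGroup F] [NormedSpace ℂ F] [CompleteSpace F]
    {u : ℝ → E} (hc : Continuous u) (hu : SubExp u) (T : E →L[ℂ] F) {z : ℂ} (hz : 0 < z.re) :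
    laplace (fun t => T (u t)) z = T (laplace u z) := by
  rw [laplace, laplace, ← T.integral_comp_comm (hu.integrableOn hc hz)]
  simp

lemma subExp_monomial (l : ℕ) (c : ℂ) : SubExp (fun t : ℝ => (t : ℂ) ^ l * c) := by
  refine SubExp.of_pow_bound (C := ‖c‖) (m := l) fun t ht => ?_
  rw [norm_mul, norm_pow, Complex.norm_real, Real.norm_of_nonneg ht, mul_comm]

/-- `t^(l+1)/(l+1)!` is the primitive of `t^l/l!` vanishing at `0`, so `laplace_of_ode` with `T = 0`
yields one factor `1/z` per induction step. -/
lemma laplace_monomial (l : ℕ) {z : ℂ} (hz : 0 < z.re) :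
    laplace (fun t : ℝ => (t : ℂ) ^ l * ((l.factorial : ℂ)⁻¹)) z = (z ^ (l + 1))⁻¹ := by
  have hz0 : z ≠ 0 := by
    rintro rfl
    simp at hz
  induction l with
  | zero =>
    have h := laplace_of_ode (E := ℂ) (u := fun _ => 1) (f := fun _ => 0) 0
      (fun t => by simpa using hasDerivAt_const t (1 : ℂ)) continuous_const
      (by simpa using subExp_monomial 0 1) (by simpa using subExp_monomial 0 0) hz
    have h0 : laplace (fun _ : ℝ => (0 : ℂ)) z = 0 := by simp [laplace]
    simp only [h0, smul_eq_mul, zero_apply, add_zero] at h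
    simp only [pow_zero, Nat.factorial_zero, Nat.cast_one, inv_one, mul_one, zero_add, pow_one]
    exact eq_inv_of_mul_eq_one_right h
  | succ l ih =>
    have h := laplace_of_ode (E := ℂ)
      (u := fun t : ℝ => (t : ℂ) ^ (l + 1) * (((l + 1).factorial : ℂ)⁻¹))
      (f := fun t : ℝ => (t : ℂ) ^ l * ((l.factorial : ℂ)⁻¹)) 0
      (fun t => by
        have h := ((hasDerivAt_pow (l + 1) (t : ℂ)).mul_const
          (((l + 1).factorial : ℂ)⁻¹)).comp_ofReal
        refine h.congr_deriv ?_
        rw [Nat.factorial_succ]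
        have : (l.factorial : ℂ) ≠ 0 := by exact_mod_cast l.factorial_ne_zero
        have : (l + 1 : ℂ) ≠ 0 := by exact_mod_cast l.succ_ne_zero
        push_cast
        change _ = -(0 : ℂ) + _
        rw [neg_zero, zero_add]
        field_simp) (by fun_prop)
      (subExp_monomial _ _) (subExp_monomial _ _) hz
    rw [ih] at h
    simp only [smul_eq_mul, zero_apply, add_zero, Complex.ofReal_zero, ne_eq,
      Nat.add_eq_zero_iff, one_ne_zero, and_false, not_false_eq_true, zero_pow, zero_mul,
      zero_add] at h
    rw [pow_succ' z (l + 1), mul_inv, ← h, inv_mul_cancel_left₀ hz0]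

/-- Laplace inversion, as a bound. -/
lemma norm_le_integral_laplace {u : ℝ → E} (hc : Continuous u) (hu : SubExp u) {ε t : ℝ}
    (hε : 0 < ε) (ht : 0 < t)
    (hi : Integrable (fun y : ℝ => laplace u (ε + y * Complex.I))) :
    ‖u t‖ ≤ Real.exp (t * ε) / (2 * Real.pi) * ∫ y : ℝ, ‖laplace u (ε + y * Complex.I)‖ := by
  -- The Fourier transform of this truncated, damped function at `ξ` is the Laplace transform of `u`
  -- at `ε + 2πiξ`.
  set f : ℝ → E := (Ioi (0 : ℝ)).indicator fun s => Complex.exp (-(ε : ℂ) * s) • u s with hf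
  have hfi : Integrable f :=
    (hu.integrableOn hc (z := (ε : ℂ)) (by simpa using hε)).integrable_indicator measurableSet_Ioi
  have hF (ξ : ℝ) : FourierTransform.fourier f ξ =
      laplace u (ε + ((2 * Real.pi * ξ : ℝ) : ℂ) * Complex.I) := by
    rw [Real.fourier_real_eq_integral_exp_smul, laplace, ← integral_indicator measurableSet_Ioi]
    congr 1
    ext s
    simp only [hf, indicator_apply]
    split_ifs
    · rw [smul_smul, ← Complex.exp_add]
      congr 2
      push_cast
      ring
    · simp
  have h2pi : (2 * Real.pi) ≠ 0 := by positivity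
  have hFi : Integrable (FourierTransform.fourier f) := by
    have : FourierTransform.fourier f = fun ξ : ℝ =>
      (fun y : ℝ => laplace u (ε + y * Complex.I)) (2 * Real.pi * ξ) := funext hF
    rw [this]
    exact hi.comp_mul_left' h2pi
  have hft : f =ᶠ[𝓝 t] fun s : ℝ => Complex.exp (-(ε : ℂ) * s) • u s := by
    filter_upwards [Ioi_mem_nhds ht] with s hs
    simp only [hf, indicator_of_mem hs]
  -- Pointwise inversion needs continuity at `t > 0` only, so a jump of `f` at `0` is harmless.
  have hcont : ContinuousAt f t := by
    refine ContinuousAt.congr ?_ hft.symm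
    exact Continuous.continuousAt (by fun_prop)
  have hinv := hfi.fourierInv_fourier_eq hFi hcont
  rw [hft.self_of_nhds, Real.fourierInv_eq'] at hinv
  have h1 := congrArg norm hinv
  rw [norm_exp_smul] at h1
  have h2 : Real.exp (-(ε : ℂ).re * t) * ‖u t‖ ≤ ∫ ξ : ℝ, ‖FourierTransform.fourier f ξ‖ := by
    rw [← h1]
    refine (norm_integral_le_integral_norm _).trans (le_of_eq ?_)
    congr 1
    ext ξ
    rw [norm_smul, Complex.norm_exp_ofReal_mul_I, one_mul]
  have h3 : ∫ ξ : ℝ, ‖FourierTransform.fourier f ξ‖ =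
      (2 * Real.pi)⁻¹ * ∫ y : ℝ, ‖laplace u (ε + y * Complex.I)‖ := by
    have := Measure.integral_comp_mul_left
      (fun y : ℝ => ‖laplace u (ε + y * Complex.I)‖) (2 * Real.pi)
    simp_rw [hF]
    rw [this, abs_of_pos (by positivity), smul_eq_mul]
  rw [h3, Complex.ofReal_re] at h2
  calc ‖u t‖ = Real.exp (t * ε) * (Real.exp (-ε * t) * ‖u t‖) := by
        rw [← mul_assoc, ← Real.exp_add]
        ring_nf
        simp
    _ ≤ Real.exp (t * ε) * ((2 * Real.pi)⁻¹ * ∫ y : ℝ, ‖laplace u (ε + y * Complex.I)‖) := by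
        gcongr
    _ = _ := by rw [div_eq_mul_inv, mul_assoc]

end Laplace

/-! ### Estimates of the scalar integral -/

section ScalarIntegral

open MeasureTheory Set

/-- From `log(1 + x) ≥ x/(1 + x)` at `x = y²/r²`; enlarging `y` to `Y` in the denominator leaves a
Gaussian in `y`, valid up to the endpoint `Y`. -/
lemma rpow_le_exp_of_le {r y Y p : ℝ} (hr : 0 < r) (hy : 0 ≤ y) (hY : y ≤ Y) (hp : 0 ≤ p) :
    (1 + y ^ 2 / r ^ 2) ^ (-(p / 2)) ≤ Real.exp (-y ^ 2 * (p / (2 * (r ^ 2 + Y ^ 2)))) := by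
  have h1 : 0 < 1 + y ^ 2 / r ^ 2 := by positivity
  rw [Real.rpow_def_of_pos h1, Real.exp_le_exp]
  have h2 : y ^ 2 / (r ^ 2 + Y ^ 2) ≤ Real.log (1 + y ^ 2 / r ^ 2) := by
    calc y ^ 2 / (r ^ 2 + Y ^ 2) ≤ y ^ 2 / (r ^ 2 + y ^ 2) := by gcongr
      _ = 1 - (1 + y ^ 2 / r ^ 2)⁻¹ := by
        have : r ^ 2 + y ^ 2 ≠ 0 := by positivity
        field_simp
        ring
      _ ≤ _ := Real.one_sub_inv_le_log_of_pos h1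
  have h3 := mul_le_mul_of_nonneg_right h2 (by positivity : 0 ≤ p / 2)
  have h4 : -y ^ 2 * (p / (2 * (r ^ 2 + Y ^ 2))) = -(y ^ 2 / (r ^ 2 + Y ^ 2) * (p / 2)) := by
    have : r ^ 2 + Y ^ 2 ≠ 0 := by positivity
    field_simp
  rw [h4]
  linarith

variable {ι : Type*} [Fintype ι]

/-- The scalar function whose integral controls the Arnoldi error. -/
def kernel (ε : ℝ) (l : ℕ) (r p : ι → ℝ) (y : ℝ) : ℝ :=
  (1 + y ^ 2 / ε ^ 2) ^ (-((l : ℝ) / 2)) * ∏ j, (1 + y ^ 2 / r j ^ 2) ^ (-(p j / 2))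

lemma kernel_nonneg (ε : ℝ) (l : ℕ) (r p : ι → ℝ) (y : ℝ) : 0 ≤ kernel ε l r p y := by
  unfold kernel
  positivity

lemma continuous_kernel (ε : ℝ) (l : ℕ) (r p : ι → ℝ) : Continuous (kernel ε l r p) := by
  unfold kernel
  refine Continuous.mul ?_ (continuous_finsetProd _ fun j _ => ?_)
  · exact Continuous.rpow_const (by fun_prop) fun y => Or.inl (by positivity)
  · exact Continuous.rpow_const (by fun_prop) fun y => Or.inl (by positivity)

lemma kernel_le_exp {ε : ℝ} (hε : 0 < ε) (l : ℕ) {r p : ι → ℝ} (hr : ∀ j, 0 < r j)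
    (hp : ∀ j, 0 ≤ p j) {y Y : ℝ} (hy : 0 ≤ y) (hY : y ≤ Y) :
    kernel ε l r p y ≤ Real.exp (-y ^ 2 *
      ((l : ℝ) / (2 * (ε ^ 2 + Y ^ 2)) + ∑ j, p j / (2 * (r j ^ 2 + Y ^ 2)))) := by
  rw [mul_add, Real.exp_add, Finset.mul_sum, Real.exp_sum]
  unfold kernel
  gcongr with j
  · exact rpow_le_exp_of_le hε hy hY (by positivity)
  · exact rpow_le_exp_of_le (hr j) hy hY (hp j)

/-- Freezes the `ε` factor at `y₀` and raises every `r j` to `R`, so that the exponents add up to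
`-m`. Used with `y₀ = 0` for integrability and with `y₀ = R` for the tail. -/
lemma kernel_le_tail {ε R : ℝ} (hε : 0 < ε) (l : ℕ) {r p : ι → ℝ} (hr : ∀ j, 0 < r j)
    (hrR : ∀ j, r j ≤ R) (hp : ∀ j, 0 ≤ p j) {m : ℝ} (hm : ∑ j, p j = 2 * m)
    {y : ℝ} (y₀ : ℝ) (hy₀ : 0 ≤ y₀) (hy : y₀ ≤ y) :
    kernel ε l r p y ≤ (ε / √(ε ^ 2 + y₀ ^ 2)) ^ l * (1 + (R⁻¹ * y) ^ 2) ^ (-m) := by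
  unfold kernel
  have h1 : (1 + y ^ 2 / ε ^ 2) ^ (-((l : ℝ) / 2)) ≤ (ε / √(ε ^ 2 + y₀ ^ 2)) ^ l := by
    calc (1 + y ^ 2 / ε ^ 2) ^ (-((l : ℝ) / 2)) ≤ (1 + y₀ ^ 2 / ε ^ 2) ^ (-((l : ℝ) / 2)) := by
          apply Real.rpow_le_rpow_of_nonpos (by positivity) (by gcongr)
          have : (0 : ℝ) ≤ l := by positivity
          linarith
      _ = (ε / √(ε ^ 2 + y₀ ^ 2)) ^ l := by
        have h2 : ε / √(ε ^ 2 + y₀ ^ 2) = (1 + y₀ ^ 2 / ε ^ 2) ^ (-(1 / 2 : ℝ)) := by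
          rw [Real.rpow_neg (by positivity), ← Real.sqrt_eq_rpow]
          have : 1 + y₀ ^ 2 / ε ^ 2 = (ε ^ 2 + y₀ ^ 2) / ε ^ 2 := by field_simp
          rw [this, Real.sqrt_div (by positivity), Real.sqrt_sq hε.le, inv_div]
        rw [h2, ← Real.rpow_mul_natCast (by positivity)]
        congr 1
        ring
  have h2 : ∏ j, (1 + y ^ 2 / r j ^ 2) ^ (-(p j / 2)) ≤ (1 + (R⁻¹ * y) ^ 2) ^ (-m) := by
    have h3 : (1 + (R⁻¹ * y) ^ 2) ^ (-m) = ∏ j, (1 + (R⁻¹ * y) ^ 2) ^ (-(p j / 2)) := by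
      rw [← Real.rpow_sum_of_pos (by positivity), Finset.sum_neg_distrib, ← Finset.sum_div, hm]
      congr 2
      ring
    rw [h3]
    refine Finset.prod_le_prod (fun j _ => by positivity) fun j _ => ?_
    apply Real.rpow_le_rpow_of_nonpos (by positivity) _ (by linarith [hp j])
    have h4 : (R⁻¹ * y) ^ 2 = y ^ 2 / R ^ 2 := by ring
    rw [h4]
    have := hr j
    have := hrR j
    gcongr
  exact mul_le_mul h1 h2 (by positivity) (by positivity)

lemma integrable_kernel {ε R : ℝ} (hε : 0 < ε) (l : ℕ) {r p : ι → ℝ} (hr : ∀ j, 0 < r j)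
    (hrR : ∀ j, r j ≤ R) (hp : ∀ j, 0 ≤ p j) {m : ℝ} (hm : ∑ j, p j = 2 * m) (hm1 : 1 ≤ m)
    (hR : 0 < R) : Integrable (kernel ε l r p) := by
  have hi : Integrable (fun y : ℝ => (1 + (R⁻¹ * y) ^ 2)⁻¹) :=
    integrable_inv_one_add_sq.comp_mul_left' (inv_ne_zero hR.ne')
  refine hi.mono' (continuous_kernel ε l r p).aestronglyMeasurable
    (Filter.Eventually.of_forall fun y => ?_)
  rw [Real.norm_of_nonneg (kernel_nonneg _ _ _ _ _)]
  have habs : kernel ε l r p y = kernel ε l r p |y| := by simp [kernel]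
  rw [habs]
  refine (kernel_le_tail hε l hr hrR hp hm 0 le_rfl (abs_nonneg y)).trans ?_
  have h1 : (R⁻¹ * |y|) ^ 2 = (R⁻¹ * y) ^ 2 := by rw [mul_pow, sq_abs, mul_pow]
  have h2 : ε / √(ε ^ 2 + 0 ^ 2) = 1 := by
    simp [Real.sqrt_sq hε.le, hε.ne']
  rw [h1, h2, one_pow, one_mul, ← Real.rpow_neg_one (1 + (R⁻¹ * y) ^ 2)]
  apply Real.rpow_le_rpow_of_exponent_le _ (by linarith)
  nlinarith [sq_nonneg (R⁻¹ * y)]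

lemma integral_Ioi_inv_one_add_inv_mul_sq {R : ℝ} (hR : 0 < R) :
    ∫ y in Ioi R, (1 + (R⁻¹ * y) ^ 2)⁻¹ = Real.pi * R / 4 := by
  rw [integral_comp_mul_left_Ioi (fun x : ℝ => (1 + x ^ 2)⁻¹) R (inv_pos.2 hR),
    inv_mul_cancel₀ hR.ne', integral_Ioi_inv_one_add_sq, Real.arctan_one, smul_eq_mul]
  field_simp
  ring

/-- On `[0, ε]` a Gaussian with `Y = ε`, integrated over the half-line; on `[ε, R]` the Gaussian
bound with `Y = R`, taken at `y = ε`; beyond `R` an algebraic tail. -/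
lemma integral_kernel_le {ε R : ℝ} (hε : 0 < ε) (hεR : ε ≤ R) (l : ℕ) {r p : ι → ℝ}
    (hr : ∀ j, 0 < r j) (hrR : ∀ j, r j ≤ R) (hp : ∀ j, 0 ≤ p j) {m : ℝ}
    (hm : ∑ j, p j = 2 * m) (hm1 : 1 ≤ m) {s₁ s₂ : ℝ}
    (hs₁ : s₁ = (l : ℝ) / (2 * (ε ^ 2 + ε ^ 2)) + ∑ j, p j / (2 * (r j ^ 2 + ε ^ 2)))
    (hs₂ : s₂ = (l : ℝ) / (2 * (ε ^ 2 + R ^ 2)) + ∑ j, p j / (2 * (r j ^ 2 + R ^ 2))) :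
    ∫ y, kernel ε l r p y ≤ 2 * (√Real.pi / (2 * √s₁) + Real.exp (-ε ^ 2 * s₂) * (R - ε)
      + (ε / √(ε ^ 2 + R ^ 2)) ^ l * (Real.pi * R / (2 : ℝ) ^ (m + 1))) := by
  have hR : 0 < R := hε.trans_le hεR
  have hi := integrable_kernel hε l hr hrR hp hm hm1 hR
  have hs₂0 : 0 ≤ s₂ := by
    rw [hs₂]
    have : ∀ j, 0 ≤ p j / (2 * (r j ^ 2 + R ^ 2)) := fun j => by
      have := hp j
      positivity
    have := Finset.sum_nonneg fun j (_ : j ∈ Finset.univ) => this j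
    positivity
  have hs₁0 : 0 < s₁ := by
    rw [hs₁]
    have h0 : ∀ j ∈ Finset.univ, 0 ≤ p j / (2 * (r j ^ 2 + ε ^ 2)) := fun j _ => by
      have := hp j
      positivity
    -- The weights sum to `2m > 0`, so one is positive; hence `s₁ > 0` even when `l = 0`, and the
    -- Gaussian is integrable.
    obtain ⟨j, -, hj⟩ : ∃ j ∈ Finset.univ, 0 < p j := by
      apply Finset.exists_lt_of_sum_lt (f := fun _ => (0 : ℝ))
      rw [hm, Finset.sum_const_zero]
      linarith
    have : 0 < ∑ j, p j / (2 * (r j ^ 2 + ε ^ 2)) :=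
      Finset.sum_pos' h0 ⟨j, Finset.mem_univ j, by positivity⟩
    positivity
  have habs : ∫ y, kernel ε l r p y = 2 * ∫ y in Ioi (0 : ℝ), kernel ε l r p y := by
    rw [← integral_comp_abs]
    simp [kernel]
  rw [habs]
  refine mul_le_mul_of_nonneg_left ?_ zero_le_two
  have hsplit : ∫ y in Ioi (0 : ℝ), kernel ε l r p y =
      (∫ y in Ioc 0 ε, kernel ε l r p y) + (∫ y in Ioc ε R, kernel ε l r p y)
        + ∫ y in Ioi R, kernel ε l r p y := by
    rw [← Ioc_union_Ioi_eq_Ioi hR.le, setIntegral_union (Ioc_disjoint_Ioi le_rfl)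
      measurableSet_Ioi hi.integrableOn hi.integrableOn, ← Ioc_union_Ioc_eq_Ioc hε.le hεR,
      setIntegral_union (Ioc_disjoint_Ioc_of_le le_rfl) measurableSet_Ioc hi.integrableOn
      hi.integrableOn]
  rw [hsplit]
  refine add_le_add (add_le_add ?_ ?_) ?_
  · have hg : Integrable (fun y : ℝ => Real.exp (-s₁ * y ^ 2)) := integrable_exp_neg_mul_sq hs₁0
    calc ∫ y in Ioc 0 ε, kernel ε l r p y ≤ ∫ y in Ioc 0 ε, Real.exp (-s₁ * y ^ 2) := by
          refine setIntegral_mono_on hi.integrableOn hg.integrableOn measurableSet_Ioc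
            fun y hy => ?_
          refine (kernel_le_exp hε l hr hp hy.1.le hy.2).trans (le_of_eq ?_)
          rw [← hs₁]
          ring_nf
      _ ≤ ∫ y in Ioi (0 : ℝ), Real.exp (-s₁ * y ^ 2) :=
          setIntegral_mono_set hg.integrableOn
            (Filter.Eventually.of_forall fun y => (Real.exp_pos _).le)
            Ioc_subset_Ioi_self.eventuallyLE
      _ = √Real.pi / (2 * √s₁) := by
          rw [integral_gaussian_Ioi, Real.sqrt_div Real.pi_pos.le]
          field_simp
  · calc ∫ y in Ioc ε R, kernel ε l r p y ≤ ∫ _ in Ioc ε R, Real.exp (-ε ^ 2 * s₂) := by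
          refine setIntegral_mono_on hi.integrableOn (integrable_const _) measurableSet_Ioc
            fun y hy => ?_
          refine (kernel_le_exp hε l hr hp (hε.trans hy.1).le hy.2).trans ?_
          rw [← hs₂, Real.exp_le_exp]
          have : ε ^ 2 ≤ y ^ 2 := by
            have := hy.1.le
            gcongr
          nlinarith
      _ = Real.exp (-ε ^ 2 * s₂) * (R - ε) := by
          rw [setIntegral_const, Real.volume_real_Ioc_of_le hεR, smul_eq_mul, mul_comm]
  -- One factor `(1 + (y/R)²)⁻¹` is kept and integrates to `πR/4`; the other `m - 1` powers are at
  -- most `2^(-(m-1))` because `y ≥ R`.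
  · have hi1 : Integrable (fun y : ℝ => (1 + (R⁻¹ * y) ^ 2)⁻¹) :=
      integrable_inv_one_add_sq.comp_mul_left' (inv_ne_zero hR.ne')
    calc ∫ y in Ioi R, kernel ε l r p y
        ≤ ∫ y in Ioi R, ((ε / √(ε ^ 2 + R ^ 2)) ^ l * 2 ^ (-(m - 1))) * (1 + (R⁻¹ * y) ^ 2)⁻¹ := by
          refine setIntegral_mono_on hi.integrableOn (hi1.const_mul _).integrableOn
            measurableSet_Ioi fun y hy => ?_
          refine (kernel_le_tail hε l hr hrR hp hm R hR.le (le_of_lt hy)).trans ?_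
          rw [mul_assoc]
          refine mul_le_mul_of_nonneg_left ?_ (by positivity)
          have h1 : (1 + (R⁻¹ * y) ^ 2) ^ (-m) =
              (1 + (R⁻¹ * y) ^ 2) ^ (-(m - 1)) * (1 + (R⁻¹ * y) ^ 2)⁻¹ := by
            rw [← Real.rpow_neg_one (1 + (R⁻¹ * y) ^ 2), ← Real.rpow_add (by positivity)]
            congr 1
            ring
          rw [h1]
          refine mul_le_mul_of_nonneg_right ?_ (by positivity)
          apply Real.rpow_le_rpow_of_nonpos (by norm_num) _ (by linarith)
          have h2 : 1 ≤ R⁻¹ * y := by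
            rw [inv_mul_eq_div, one_le_div hR]
            exact le_of_lt hy
          nlinarith
      _ = _ := by
          rw [integral_const_mul, integral_Ioi_inv_one_add_inv_mul_sq hR, mul_assoc]
          congr 1
          rw [Real.rpow_neg zero_le_two, Real.rpow_sub_one two_ne_zero,
            Real.rpow_add_one two_ne_zero]
          field_simp
          ring

end ScalarIntegral

/-! ### One-parameter exponentials -/

section Exp

variable {𝔸 : Type*} [NormedRing 𝔸] [NormedAlgebra ℝ 𝔸] [CompleteSpace 𝔸]

lemma exp_add_smul (T : 𝔸) (s t : ℝ) :
    NormedSpace.exp ((s + t) • T) = NormedSpace.exp (s • T) * NormedSpace.exp (t • T) := by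
  let _ : NormedAlgebra ℚ 𝔸 := NormedAlgebra.restrictScalars ℚ ℝ 𝔸
  rw [add_smul, NormedSpace.exp_add_of_commute]
  exact ((Commute.refl T).smul_left _).smul_right _

lemma exp_neg_smul_mul_exp_smul (T : 𝔸) (t : ℝ) :
    NormedSpace.exp ((-t) • T) * NormedSpace.exp (t • T) = 1 := by
  rw [← exp_add_smul, neg_add_cancel, zero_smul, NormedSpace.exp_zero]

lemma hasDerivAt_exp_neg_smul (T : 𝔸) (t : ℝ) :
    HasDerivAt (fun s : ℝ => NormedSpace.exp ((-s) • T))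
      (-(T * NormedSpace.exp ((-t) • T))) t := by
  have h := hasDerivAt_exp_smul_const' (-T) t
  simpa only [neg_smul, smul_neg, neg_mul] using h

lemma continuous_exp_smul (T : 𝔸) : Continuous (fun s : ℝ => NormedSpace.exp (s • T)) :=
  continuous_iff_continuousAt.2 fun t => (hasDerivAt_exp_smul_const' T t).continuousAt

end Exp

/-! ### The flow `t^ℓ φ_ℓ(-tM)` -/

section Flow

open MeasureTheory

variable {m n : ℕ}

/-- `act M` as a continuous linear map. -/
def actCLM (M : Matrix (Fin m) (Fin n) ℝ) :
    EuclideanSpace ℝ (Fin n) →L[ℝ] EuclideanSpace ℝ (Fin m) :=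
  LinearMap.toContinuousLinearMap
    { toFun := act M
      map_add' := fun x y => by simp [act, Matrix.mulVec_add]
      map_smul' := fun c x => by simp [act, Matrix.mulVec_smul] }

lemma actCLM_apply (M : Matrix (Fin m) (Fin n) ℝ) (x : EuclideanSpace ℝ (Fin n)) :
    actCLM M x = act M x := rfl

lemma act_add (M : Matrix (Fin m) (Fin n) ℝ) (x y : EuclideanSpace ℝ (Fin n)) :
    act M (x + y) = act M x + act M y := (actCLM M).map_add x y

lemma act_smul (M : Matrix (Fin m) (Fin n) ℝ) (c : ℝ) (x : EuclideanSpace ℝ (Fin n)) :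
    act M (c • x) = c • act M x := (actCLM M).map_smul c x

lemma act_neg (M : Matrix (Fin m) (Fin n) ℝ) (x : EuclideanSpace ℝ (Fin n)) :
    act M (-x) = -act M x := (actCLM M).map_neg x

lemma act_sub (M : Matrix (Fin m) (Fin n) ℝ) (x y : EuclideanSpace ℝ (Fin n)) :
    act M (x - y) = act M x - act M y := (actCLM M).map_sub x y

lemma smul_act (c : ℝ) (M : Matrix (Fin m) (Fin n) ℝ) (x : EuclideanSpace ℝ (Fin n)) :
    act (c • M) x = c • act M x := by
  simp [act, Matrix.smul_mulVec]

lemma act_one (x : EuclideanSpace ℝ (Fin m)) : act (1 : Matrix (Fin m) (Fin m) ℝ) x = x := by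
  simp [act]

/-- The operator on real Euclidean space given by a square matrix. -/
def op (M : Matrix (Fin m) (Fin m) ℝ) : EuclideanSpace ℝ (Fin m) →L[ℝ] EuclideanSpace ℝ (Fin m) :=
  Matrix.toEuclideanCLM (𝕜 := ℝ) M

lemma op_apply (M : Matrix (Fin m) (Fin m) ℝ) (x : EuclideanSpace ℝ (Fin m)) :
    op M x = act M x := by
  ext i
  rw [op, Matrix.ofLp_toEuclideanCLM, act]

lemma op_smul (c : ℝ) (M : Matrix (Fin m) (Fin m) ℝ) : op (c • M) = c • op M :=
  map_smul (Matrix.toEuclideanCLM (𝕜 := ℝ)) c M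

/-- Carries the matrix exponential to the Banach algebra of operators, where derivatives and
Euclidean norms are available; the matrix norm chosen here is auxiliary. -/
lemma op_exp (M : Matrix (Fin m) (Fin m) ℝ) :
    op (NormedSpace.exp M) = NormedSpace.exp (op M) := by
  let _ : NormedRing (Matrix (Fin m) (Fin m) ℝ) := Matrix.linftyOpNormedRing
  let _ : NormedAlgebra ℝ (Matrix (Fin m) (Fin m) ℝ) := Matrix.linftyOpNormedAlgebra
  let _ : NormedAlgebra ℚ (Matrix (Fin m) (Fin m) ℝ) := NormedAlgebra.restrictScalars ℚ ℝ _
  have hc : Continuous (Matrix.toEuclideanCLM (n := Fin m) (𝕜 := ℝ)) :=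
    LinearMap.continuous_of_finiteDimensional
      ((Matrix.toEuclideanCLM (n := Fin m) (𝕜 := ℝ)).toAlgEquiv.toLinearEquiv.toLinearMap)
  exact NormedSpace.map_exp (Matrix.toEuclideanCLM (n := Fin m) (𝕜 := ℝ)) hc M

lemma act_exp_smul (c : ℝ) (M : Matrix (Fin m) (Fin m) ℝ) (x : EuclideanSpace ℝ (Fin m)) :
    act (NormedSpace.exp (c • M)) x = NormedSpace.exp (c • op M) x := by
  rw [← op_apply, op_exp, op_smul]

/-- The matrix function `t ^ ℓ φ_ℓ(-t M)`. -/
def flow (l : ℕ) (M : Matrix (Fin m) (Fin m) ℝ) (t : ℝ) : Matrix (Fin m) (Fin m) ℝ :=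
  t ^ l • phi l ((-t) • M)

lemma continuous_exp_smul_apply (N : Matrix (Fin m) (Fin m) ℝ) (i j : Fin m) :
    Continuous (fun s : ℝ => NormedSpace.exp (s • N) i j) := by
  have h : (fun s : ℝ => NormedSpace.exp (s • N) i j) =
      fun s : ℝ => (NormedSpace.exp (s • op N) (EuclideanSpace.single j 1)) i := by
    ext1 s
    rw [← act_exp_smul]
    simp [act]
  rw [h]
  have := (continuous_exp_smul (op N)).clm_apply
    (continuous_const (y := (EuclideanSpace.single j 1 : EuclideanSpace ℝ (Fin m))))
  fun_prop

lemma act_phi_succ_eq_integral (l : ℕ) (N : Matrix (Fin m) (Fin m) ℝ)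
    (x : EuclideanSpace ℝ (Fin m)) :
    act (phi (l + 1) N) x = (l.factorial : ℝ)⁻¹ •
      ∫ θ in (0 : ℝ)..1, θ ^ l • NormedSpace.exp ((1 - θ) • op N) x := by
  have hi : IntervalIntegrable (fun θ : ℝ => θ ^ l • NormedSpace.exp ((1 - θ) • op N) x)
      volume 0 1 := by
    refine Continuous.intervalIntegrable ?_ 0 1
    exact (continuous_pow l).smul (((continuous_exp_smul (op N)).comp
      (continuous_const.sub continuous_id)).clm_apply continuous_const)
  have hij (i j : Fin m) : IntervalIntegrable
      (fun θ : ℝ => NormedSpace.exp ((1 - θ) • N) i j * θ ^ l * x j) volume 0 1 := by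
    refine Continuous.intervalIntegrable ?_ 0 1
    exact (((continuous_exp_smul_apply N i j).comp (continuous_const.sub continuous_id)).mul
      (continuous_pow l)).mul continuous_const
  ext i
  have h := (EuclideanSpace.proj (𝕜 := ℝ) i).intervalIntegral_comp_comm hi
  rw [PiLp.smul_apply, smul_eq_mul]
  refine Eq.trans ?_ (congrArg ((l.factorial : ℝ)⁻¹ * ·) h)
  have h1 : (fun θ : ℝ => EuclideanSpace.proj (𝕜 := ℝ) i
      (θ ^ l • NormedSpace.exp ((1 - θ) • op N) x)) =
      fun θ : ℝ => ∑ j, NormedSpace.exp ((1 - θ) • N) i j * θ ^ l * x j := by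
    ext1 θ
    rw [← act_exp_smul]
    change θ ^ l * ∑ j, NormedSpace.exp ((1 - θ) • N) i j * x j = _
    rw [Finset.mul_sum]
    exact Finset.sum_congr rfl fun j _ => by ring
  rw [h1, intervalIntegral.integral_finsetSum fun j _ => hij i j, Finset.mul_sum]
  change ∑ j, phi (l + 1) N i j * x j = _
  refine Finset.sum_congr rfl fun j _ => ?_
  rw [intervalIntegral.integral_mul_const, phi, Matrix.of_apply, one_div, mul_assoc]

lemma exp_add_smul_op (M : Matrix (Fin m) (Fin m) ℝ) (s t : ℝ) :
    NormedSpace.exp ((s + t) • op M) =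
      NormedSpace.exp (s • op M) * NormedSpace.exp (t • op M) :=
  exp_add_smul (op M) s t

/-- The substitution `s = θt` turns the defining integral into Duhamel's formula: `t^l` is absorbed
into `s^l` and the last factor `t` into `ds`. -/
lemma act_flow_succ_eq (l : ℕ) (M : Matrix (Fin m) (Fin m) ℝ) (x : EuclideanSpace ℝ (Fin m))
    (t : ℝ) : act (flow (l + 1) M t) x = NormedSpace.exp ((-t) • op M)
      (∫ s in (0 : ℝ)..t, (s ^ l * (l.factorial : ℝ)⁻¹) • NormedSpace.exp (s • op M) x) := by
  have h := intervalIntegral.smul_integral_comp_mul_right (a := 0) (b := 1)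
    (fun s : ℝ => (s ^ l * (l.factorial : ℝ)⁻¹) • NormedSpace.exp (s • op M) x) t
  rw [zero_mul, one_mul] at h
  have hi : IntervalIntegrable (fun θ : ℝ => ((θ * t) ^ l * (l.factorial : ℝ)⁻¹) •
      NormedSpace.exp ((θ * t) • op M) x) volume 0 1 := by
    refine Continuous.intervalIntegrable ?_ 0 1
    refine Continuous.smul (((continuous_id.mul continuous_const).pow l).mul continuous_const) ?_
    exact ((continuous_exp_smul (op M)).comp (continuous_id.mul continuous_const)).clm_apply
      continuous_const
  rw [← h, flow, smul_act, act_phi_succ_eq_integral, map_smul,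
    ← ContinuousLinearMap.intervalIntegral_comp_comm _ hi, pow_succ', mul_smul,
    ← intervalIntegral.integral_smul, ← intervalIntegral.integral_smul]
  congr 1
  refine intervalIntegral.integral_congr fun θ _ => ?_
  have h1 : (1 - θ) • op ((-t) • M) = (-t + θ * t) • op M := by
    rw [op_smul, smul_smul]
    ring_nf
  simp only [h1]
  rw [exp_add_smul_op, map_smul, smul_smul, smul_smul, mul_apply_eq_comp]
  congr 1
  ring

/-- The inhomogeneous term of the equation satisfied by `t ^ ℓ φ_ℓ(-t M)`. -/
def flowSource : ℕ → ℝ → ℝ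
  | 0, _ => 0
  | l + 1, t => t ^ l * (l.factorial : ℝ)⁻¹

lemma act_flow_zero (M : Matrix (Fin m) (Fin m) ℝ) (x : EuclideanSpace ℝ (Fin m)) (t : ℝ) :
    act (flow 0 M t) x = NormedSpace.exp ((-t) • op M) x := by
  rw [← act_exp_smul]
  simp [flow, phi]

lemma hasDerivAt_act_flow (l : ℕ) (M : Matrix (Fin m) (Fin m) ℝ) (x : EuclideanSpace ℝ (Fin m))
    (t : ℝ) : HasDerivAt (fun s => act (flow l M s) x)
      (-(act M (act (flow l M t) x)) + flowSource l t • x) t := by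
  cases l with
  | zero =>
    simp only [act_flow_zero]
    refine ((hasDerivAt_exp_neg_smul (op M) t).clm_apply (hasDerivAt_const t x)).congr_deriv ?_
    rw [flowSource, zero_smul, add_zero, map_zero, add_zero, ← op_apply]
    rfl
  | succ l =>
    simp only [act_flow_succ_eq]
    have hcont : Continuous (fun s : ℝ => (s ^ l * (l.factorial : ℝ)⁻¹) •
        NormedSpace.exp (s • op M) x) :=
      Continuous.smul ((continuous_pow l).mul continuous_const) ((continuous_exp_smul (op M)).clm_apply continuous_const)
    have hJ := (hcont.integral_hasStrictDerivAt 0 t).hasDerivAt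
    refine ((hasDerivAt_exp_neg_smul (op M) t).clm_apply hJ).congr_deriv ?_
    have h1 : NormedSpace.exp ((-t) • op M) * NormedSpace.exp (t • op M) = 1 :=
      exp_neg_smul_mul_exp_smul (op M) t
    rw [map_smul, ← mul_apply_eq_comp, h1, ← op_apply]
    rfl

lemma flow_zero_zero (M : Matrix (Fin m) (Fin m) ℝ) : flow 0 M 0 = 1 := by
  simp [flow, phi]

lemma flow_succ_zero (l : ℕ) (M : Matrix (Fin m) (Fin m) ℝ) : flow (l + 1) M 0 = 0 := by
  simp [flow]

/-- By accretivity, `d/dt ‖u‖² = -2⟨u, Mu⟩ ≤ 0` along `u' = -Mu`. -/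
lemma norm_exp_op_le {M : Matrix (Fin m) (Fin m) ℝ}
    (hM : ∀ x : EuclideanSpace ℝ (Fin m), 0 ≤ inner ℝ x (act M x))
    (x : EuclideanSpace ℝ (Fin m)) {t : ℝ} (ht : 0 ≤ t) :
    ‖NormedSpace.exp ((-t) • op M) x‖ ≤ ‖x‖ := by
  have hd (s : ℝ) := (hasDerivAt_act_flow 0 M x s).norm_sq
  have hanti : Antitone (fun s : ℝ => ‖act (flow 0 M s) x‖ ^ 2) := by
    refine antitone_of_hasDerivAt_nonpos hd fun s => ?_
    rw [flowSource, zero_smul, add_zero, inner_neg_right]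
    have := hM (act (flow 0 M s) x)
    simp only [Pi.zero_apply]
    linarith
  have h := hanti ht
  simp only [flow_zero_zero, act_one, act_flow_zero] at h
  exact (sq_le_sq₀ (norm_nonneg _) (norm_nonneg _)).1 h

/-- The crude bounds `θ^l ≤ 1` and `1/l! ≤ 1` suffice, since only subexponential growth of the flow
is at stake. -/
lemma norm_act_phi_le {M : Matrix (Fin m) (Fin m) ℝ}
    (hM : ∀ x : EuclideanSpace ℝ (Fin m), 0 ≤ inner ℝ x (act M x))
    (x : EuclideanSpace ℝ (Fin m)) (l : ℕ) {t : ℝ} (ht : 0 ≤ t) :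
    ‖act (phi l ((-t) • M)) x‖ ≤ ‖x‖ := by
  cases l with
  | zero =>
    rw [phi, act_exp_smul]
    exact norm_exp_op_le hM x ht
  | succ l =>
    rw [act_phi_succ_eq_integral, norm_smul]
    have h1 : ‖∫ θ in (0 : ℝ)..1, θ ^ l • NormedSpace.exp ((1 - θ) • op ((-t) • M)) x‖
        ≤ ‖x‖ * |1 - 0| := by
      refine intervalIntegral.norm_integral_le_of_norm_le_const fun θ hθ => ?_
      rw [Set.uIoc_of_le zero_le_one] at hθ
      rw [norm_smul, norm_pow, Real.norm_of_nonneg hθ.1.le]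
      have h2 : (1 - θ) • op ((-t) • M) = (-((1 - θ) * t)) • op M := by
        rw [op_smul, smul_smul]
        ring_nf
      rw [h2]
      have h3 := norm_exp_op_le hM x (mul_nonneg (sub_nonneg.2 hθ.2) ht)
      calc θ ^ l * _ ≤ 1 * ‖x‖ :=
            mul_le_mul (pow_le_one₀ hθ.1.le hθ.2) h3 (norm_nonneg _) zero_le_one
        _ = ‖x‖ := one_mul _
    have h4 : ‖(l.factorial : ℝ)⁻¹‖ ≤ 1 := by
      rw [norm_inv, Real.norm_natCast]
      exact inv_le_one_of_one_le₀ (by exact_mod_cast l.factorial_pos)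
    calc _ ≤ 1 * (‖x‖ * |1 - 0|) := mul_le_mul h4 h1 (norm_nonneg _) zero_le_one
      _ = ‖x‖ := by simp

lemma norm_act_flow_le {M : Matrix (Fin m) (Fin m) ℝ}
    (hM : ∀ x : EuclideanSpace ℝ (Fin m), 0 ≤ inner ℝ x (act M x))
    (x : EuclideanSpace ℝ (Fin m)) (l : ℕ) {t : ℝ} (ht : 0 ≤ t) :
    ‖act (flow l M t) x‖ ≤ ‖x‖ * t ^ l := by
  rw [flow, smul_act, norm_smul, norm_pow, Real.norm_of_nonneg ht, mul_comm]
  exact mul_le_mul_of_nonneg_right (norm_act_phi_le hM x l ht) (by positivity)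

end Flow

/-! ### Complexification and resolvent bounds -/

section Complexification

variable {m n : ℕ}

/-- The embedding of real Euclidean space into complex Euclidean space. -/
def cplx (n : ℕ) : EuclideanSpace ℝ (Fin n) →L[ℝ] EuclideanSpace ℂ (Fin n) :=
  LinearMap.toContinuousLinearMap
    { toFun := fun x => WithLp.toLp 2 fun i => (x i : ℂ)
      map_add' := fun x y => by
        ext i
        simp
      map_smul' := fun c x => by
        ext i
        simp }

lemma cplx_apply (x : EuclideanSpace ℝ (Fin n)) (i : Fin n) : cplx n x i = (x i : ℂ) := rfl

lemma norm_cplx (x : EuclideanSpace ℝ (Fin n)) : ‖cplx n x‖ = ‖x‖ := by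
  simp [EuclideanSpace.norm_eq, cplx_apply]

/-- The operator on complex Euclidean space given by a real matrix. -/
def cact (M : Matrix (Fin m) (Fin m) ℝ) :
    EuclideanSpace ℂ (Fin m) →L[ℂ] EuclideanSpace ℂ (Fin m) :=
  Matrix.toEuclideanCLM (𝕜 := ℂ) (M.map (fun x : ℝ => (x : ℂ)))

lemma ofLp_cact (M : Matrix (Fin m) (Fin m) ℝ) (z : EuclideanSpace ℂ (Fin m)) :
    (cact M z).ofLp = M.map (fun x : ℝ => (x : ℂ)) *ᵥ z.ofLp :=
  Matrix.ofLp_toEuclideanCLM _ _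

lemma cact_cplx (M : Matrix (Fin m) (Fin m) ℝ) (x : EuclideanSpace ℝ (Fin m)) :
    cact M (cplx m x) = cplx m (act M x) := by
  ext i
  rw [cplx_apply, ofLp_cact]
  simp [act, Matrix.mulVec, dotProduct, cplx_apply]

lemma exists_eq_cplx_add (z : EuclideanSpace ℂ (Fin m)) :
    ∃ p q : EuclideanSpace ℝ (Fin m), z = cplx m p + Complex.I • cplx m q := by
  refine ⟨WithLp.toLp 2 fun i => (z i).re, WithLp.toLp 2 fun i => (z i).im, ?_⟩
  ext i
  simp [cplx_apply, mul_comm Complex.I, Complex.re_add_im]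

lemma inner_cplx (x y : EuclideanSpace ℝ (Fin m)) :
    inner ℂ (cplx m x) (cplx m y) = ((inner ℝ x y : ℝ) : ℂ) := by
  simp [PiLp.inner_apply, cplx_apply]

lemma re_inner_cplx_add (p q p' q' : EuclideanSpace ℝ (Fin m)) :
    (inner ℂ (cplx m p + Complex.I • cplx m q) (cplx m p' + Complex.I • cplx m q')).re
      = inner ℝ p p' + inner ℝ q q' := by
  simp [inner_cplx]

/-- For a real matrix the cross terms of `⟨p + iq, M(p + iq)⟩` are purely imaginary, so the real
lower bound passes to complex vectors. -/
lemma re_inner_cact_ge {M : Matrix (Fin m) (Fin m) ℝ} {a : ℝ}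
    (hM : ∀ x : EuclideanSpace ℝ (Fin m), a * ‖x‖ ^ 2 ≤ inner ℝ x (act M x))
    (z : EuclideanSpace ℂ (Fin m)) : a * ‖z‖ ^ 2 ≤ (inner ℂ z (cact M z)).re := by
  obtain ⟨p, q, rfl⟩ := exists_eq_cplx_add z
  have h1 : ‖cplx m p + Complex.I • cplx m q‖ ^ 2 = ‖p‖ ^ 2 + ‖q‖ ^ 2 := by
    have h := re_inner_cplx_add p q p q
    rw [real_inner_self_eq_norm_sq, real_inner_self_eq_norm_sq] at h
    rw [← h]
    exact (inner_self_eq_norm_sq (𝕜 := ℂ) _).symm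
  rw [h1, map_add, map_smul, cact_cplx, cact_cplx, re_inner_cplx_add]
  linarith [hM p, hM q]

/-- Cauchy–Schwarz applied to `Re⟨z, (s + M)z⟩`; for `s.re + a > 0` this is the resolvent bound `‖(s
+ M)⁻¹‖ ≤ 1/(s.re + a)`. -/
lemma norm_smul_add_cact_ge {M : Matrix (Fin m) (Fin m) ℝ} {a : ℝ}
    (hM : ∀ x : EuclideanSpace ℝ (Fin m), a * ‖x‖ ^ 2 ≤ inner ℝ x (act M x))
    (s : ℂ) (z : EuclideanSpace ℂ (Fin m)) : (s.re + a) * ‖z‖ ≤ ‖s • z + cact M z‖ := by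
  rcases eq_or_ne z 0 with rfl | hz
  · simp
  have h1 := re_inner_cact_ge hM z
  have h2 : (inner ℂ z (s • z + cact M z)).re = s.re * ‖z‖ ^ 2 + (inner ℂ z (cact M z)).re := by
    rw [inner_add_right, inner_smul_right, inner_self_eq_norm_sq_to_K, Complex.add_re]
    congr 1
    change (s * (‖z‖ : ℂ) ^ 2).re = _
    rw [← Complex.ofReal_pow, Complex.re_mul_ofReal]
  have h3 : (inner ℂ z (s • z + cact M z)).re ≤ ‖z‖ * ‖s • z + cact M z‖ :=
    (Complex.re_le_norm _).trans (norm_inner_le_norm _ _)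
  have hz0 : 0 < ‖z‖ := norm_pos_iff.2 hz
  refine le_of_mul_le_mul_left ?_ hz0
  nlinarith

/-- An eigenvector for `s` is annihilated by `-s + M`, so the preceding lower bound forces `-s.re +
a ≤ 0`. -/
lemma re_ge_of_mem_roots_charpoly {M : Matrix (Fin m) (Fin m) ℝ} {a : ℝ}
    (hM : ∀ x : EuclideanSpace ℝ (Fin m), a * ‖x‖ ^ 2 ≤ inner ℝ x (act M x)) {s : ℂ}
    (hs : s ∈ (M.map (fun x : ℝ => (x : ℂ))).charpoly.roots) : a ≤ s.re := by
  have h1 := Polynomial.isRoot_of_mem_roots hs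
  rw [Polynomial.IsRoot, Matrix.eval_charpoly, ← Matrix.exists_mulVec_eq_zero_iff] at h1
  obtain ⟨x, hx, h⟩ := h1
  have hx' : WithLp.toLp 2 x ≠ (0 : EuclideanSpace ℂ (Fin m)) := by
    simpa using hx
  have h2 : (-s) • (WithLp.toLp 2 x : EuclideanSpace ℂ (Fin m)) + cact M (WithLp.toLp 2 x) = 0 := by
    rw [Matrix.sub_mulVec, sub_eq_zero] at h
    ext i
    have := congrFun h i
    rw [PiLp.add_apply, ofLp_cact, ← this]
    simp [Matrix.mulVec_diagonal]
  have h3 := norm_smul_add_cact_ge hM (-s) (WithLp.toLp 2 x)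
  rw [h2, norm_zero, Complex.neg_re] at h3
  have h4 := norm_pos_iff.2 hx'
  by_contra! h5
  nlinarith [mul_pos (show 0 < -s.re + a by linarith) h4]

lemma hasDerivAt_cplx {u : ℝ → EuclideanSpace ℝ (Fin m)} {u' : EuclideanSpace ℝ (Fin m)} {t : ℝ}
    (h : HasDerivAt u u' t) : HasDerivAt (fun s => cplx m (u s)) (cplx m u') t :=
  (cplx m).hasFDerivAt.comp_hasDerivAt t h

lemma subExp_flow {k : ℕ} {M : Matrix (Fin k) (Fin k) ℝ}
    (hM : ∀ x : EuclideanSpace ℝ (Fin k), 0 ≤ inner ℝ x (act M x))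
    (x : EuclideanSpace ℝ (Fin k)) (l : ℕ) : SubExp (fun t => cplx k (act (flow l M t) x)) :=
  SubExp.of_pow_bound (C := ‖x‖) (m := l) fun t ht => by
    rw [norm_cplx]
    exact norm_act_flow_le hM x l ht

/-- The right-hand side comes from the initial value when `l = 0` and from the transform of the
monomial source otherwise. -/
lemma laplace_flow {M : Matrix (Fin m) (Fin m) ℝ}
    (hM : ∀ x : EuclideanSpace ℝ (Fin m), 0 ≤ inner ℝ x (act M x))
    (x : EuclideanSpace ℝ (Fin m)) (l : ℕ) {z : ℂ} (hz : 0 < z.re) :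
    z • laplace (fun t => cplx m (act (flow l M t) x)) z
      + cact M (laplace (fun t => cplx m (act (flow l M t) x)) z) = (z ^ l)⁻¹ • cplx m x := by
  have hsub := subExp_flow hM x l
  have hd (t : ℝ) : HasDerivAt (fun t => cplx m (act (flow l M t) x))
      (-(cact M (cplx m (act (flow l M t) x))) + (flowSource l t : ℂ) • cplx m x) t := by
    refine (hasDerivAt_cplx (hasDerivAt_act_flow l M x t)).congr_deriv ?_
    rw [map_add, map_neg, map_smul, cact_cplx, Complex.coe_smul]
  cases l with
  | zero =>
    have h := laplace_of_ode (cact M) (f := fun _ => 0) (fun t => by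
      simpa [flowSource] using hd t) continuous_const hsub
      (SubExp.of_pow_bound (C := 0) (m := 0) (by simp)) hz
    rw [h, flow_zero_zero, act_one]
    simp [laplace]
  | succ l =>
    have hs := subExp_monomial l ((l.factorial : ℂ)⁻¹)
    have hcs : Continuous (fun t : ℝ => (t : ℂ) ^ l * (l.factorial : ℂ)⁻¹) := by fun_prop
    let T : ℂ →L[ℂ] EuclideanSpace ℂ (Fin m) := ContinuousLinearMap.toSpanSingleton ℂ (cplx m x)
    have hf : (fun t : ℝ => (flowSource (l + 1) t : ℂ) • cplx m x) =
        fun t : ℝ => T ((t : ℂ) ^ l * (l.factorial : ℂ)⁻¹) := by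
      ext1 t
      simp [T, flowSource]
    have h := laplace_of_ode (cact M) hd (by rw [hf]; exact T.continuous.comp hcs) hsub
      (by rw [hf]; exact hs.clm T) hz
    rw [h, hf, laplace_clm hcs hs T hz, laplace_monomial l hz, flow_succ_zero]
    simp [T, act]

end Complexification

/-! ### Cramer's rule for Hessenberg matrices -/

section Hessenberg

/-- The relevant minor deletes the first row and last column, leaving an upper triangular matrix
with the subdiagonal of `M` on its diagonal. -/
lemma norm_det_mul_norm_last_of_hessenberg {m : ℕ} {M : Matrix (Fin (m + 1)) (Fin (m + 1)) ℂ}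
    (hM : ∀ i j : Fin (m + 1), j.val + 1 < i.val → M i j = 0) {x : Fin (m + 1) → ℂ} {c : ℂ}
    (hx : M *ᵥ x = Pi.single 0 c) :
    ‖M.det‖ * ‖x (Fin.last m)‖ = ‖c‖ * ∏ i : Fin m, ‖M i.succ i.castSucc‖ := by
  have h1 : M.adjugate *ᵥ (M *ᵥ x) = M.det • x := by
    rw [Matrix.mulVec_mulVec, Matrix.adjugate_mul, Matrix.smul_mulVec, Matrix.one_mulVec]
  have h2 := congrFun h1 (Fin.last m)
  rw [hx, Matrix.mulVec_single, Pi.smul_apply, Pi.smul_apply, Matrix.col_apply,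
    Matrix.adjugate_fin_succ_eq_det_submatrix] at h2
  have h3 : (M.submatrix (Fin.succAbove 0) (Fin.last m).succAbove).det =
      ∏ i : Fin m, M i.succ i.castSucc := by
    rw [Matrix.det_of_isUpperTriangular]
    · simp
    · intro i j hij
      simp only [Matrix.submatrix_apply, Fin.succAbove_zero, Fin.succAbove_last]
      refine hM _ _ ?_
      have : j.val < i.val := hij
      simpa using this
  rw [h3] at h2
  have h4 := congrArg norm h2
  simp only [MulOpposite.smul_eq_mul_unop, MulOpposite.unop_op, norm_mul, norm_pow, norm_neg,
    norm_one, one_pow, one_mul, norm_prod, smul_eq_mul] at h4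
  rw [← h4, mul_comm]

end Hessenberg

/-! ### Lower bound for `|det(z + H)|` and the constant `C_k` -/

section Spectrum

variable {k : ℕ} {H : Matrix (Fin k) (Fin k) ℝ} {k₁ : ℕ} {μ : Fin k → ℂ}

/-- The complex matrix `z + H`. -/
def shifted (H : Matrix (Fin k) (Fin k) ℝ) (z : ℂ) : Matrix (Fin k) (Fin k) ℂ :=
  z • 1 + H.map (fun x : ℝ => (x : ℂ))

lemma norm_det_shifted (hμ : IsEigenvalueList H k₁ μ) (z : ℂ) :
    ‖(shifted H z).det‖ = ∏ j, ‖z + μ j‖ := by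
  have h1 := (IsAlgClosed.splits (H.map (fun x : ℝ => (x : ℂ))).charpoly).eq_prod_roots
  rw [(Matrix.charpoly_monic _).leadingCoeff, map_one, one_mul, hμ.roots_eq, Multiset.map_map] at h1
  have h2 := congrArg (Polynomial.eval (-z)) h1
  rw [Matrix.eval_charpoly] at h2
  have h3 : (Matrix.scalar (Fin k)) (-z) - H.map (fun x : ℝ => (x : ℂ)) = -shifted H z := by
    rw [shifted, neg_add, sub_eq_add_neg, Matrix.smul_one_eq_diagonal, map_neg,
      Matrix.scalar_apply]
  rw [h3, Matrix.det_neg] at h2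
  have h4 := congrArg norm h2
  change _ = ‖Polynomial.eval (-z) (∏ j, (Polynomial.X - Polynomial.C (μ j)))‖ at h4
  rw [Polynomial.eval_prod, norm_prod, norm_mul, norm_pow, norm_neg, norm_one, one_pow,
    one_mul] at h4
  rw [h4]
  refine Finset.prod_congr rfl fun j _ => ?_
  rw [Polynomial.eval_sub, Polynomial.eval_X, Polynomial.eval_C, ← norm_neg]
  congr 1
  ring

lemma norm_det_shifted_conj (H : Matrix (Fin k) (Fin k) ℝ) (z : ℂ) :
    ‖(shifted H (starRingEnd ℂ z)).det‖ = ‖(shifted H z).det‖ := by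
  have h : shifted H (starRingEnd ℂ z) = (starRingEnd ℂ).mapMatrix (shifted H z) := by
    ext i j
    simp [shifted, Matrix.one_apply, apply_ite (starRingEnd ℂ)]
  rw [h, ← RingHom.map_det, RCLike.norm_conj]

/-- After squaring and clearing denominators the difference of the two sides is `b²(α² + b² - y²)² ≥
0`. -/
lemma rad_mul_le_norm_mul_norm {α b : ℝ} (hα : 0 < α) (y : ℝ) :
    √(α ^ 2 + b ^ 2) * α * (1 + y ^ 2 / √(α ^ 2 + b ^ 2) ^ 2) ≤
      √(α ^ 2 + (b + y) ^ 2) * √(α ^ 2 + (b - y) ^ 2) := by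
  have hr2 : 0 < α ^ 2 + b ^ 2 := by positivity
  rw [← Real.sqrt_mul (by positivity), Real.sq_sqrt hr2.le]
  apply Real.le_sqrt_of_sq_le
  rw [mul_pow, mul_pow, Real.sq_sqrt hr2.le]
  have h : (α ^ 2 + b ^ 2) * α ^ 2 * (1 + y ^ 2 / (α ^ 2 + b ^ 2)) ^ 2 =
      α ^ 2 * (α ^ 2 + b ^ 2 + y ^ 2) ^ 2 / (α ^ 2 + b ^ 2) := by
    field_simp
  rw [h, div_le_iff₀ hr2]
  nlinarith [mul_nonneg (sq_nonneg b) (sq_nonneg (α ^ 2 + b ^ 2 - y ^ 2))]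

lemma rad_pos {ε : ℝ} {j : Fin k} (h : 0 < ε + (μ j).re) : 0 < rad μ ε j := by
  unfold rad
  positivity

lemma omega_mul_prod_le_norm_det (hμ : IsEigenvalueList H k₁ μ) {ε : ℝ}
    (hα : ∀ j, 0 < ε + (μ j).re) (y : ℝ) :
    omega μ ε * ∏ j, √(1 + y ^ 2 / rad μ ε j ^ 2) ≤
      ‖(shifted H (ε + y * Complex.I)).det‖ := by
  have hr : ∀ j, 0 < rad μ ε j := fun j => rad_pos (hα j)
  refine le_of_sq_le_sq ?_ (norm_nonneg _)
  -- Since `H` is real, `z` and `z̄` give determinants of equal modulus; each `μ j` is thus paired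
  -- with itself, and conjugate eigenvalues need not be matched in the list.
  have h1 : ‖(shifted H (ε + y * Complex.I)).det‖ ^ 2 =
      ∏ j, (‖(ε + y * Complex.I) + μ j‖ * ‖starRingEnd ℂ (ε + y * Complex.I) + μ j‖) := by
    rw [Finset.prod_mul_distrib, ← norm_det_shifted hμ, ← norm_det_shifted hμ,
      norm_det_shifted_conj, sq]
  rw [h1, omega, ← Finset.prod_mul_distrib, ← Finset.prod_pow]
  refine Finset.prod_le_prod (fun j _ => by positivity) fun j _ => ?_
  have := hα j
  have := hr j
  rw [mul_pow, Real.sq_sqrt (by positivity), Real.sq_sqrt (by positivity)]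
  refine (rad_mul_le_norm_mul_norm (hα j) y).trans (le_of_eq ?_)
  rw [Complex.norm_eq_sqrt_sq_add_sq, Complex.norm_eq_sqrt_sq_add_sq]
  simp only [map_add, map_mul, Complex.conj_ofReal, Complex.conj_I, Complex.add_re,
    Complex.add_im, Complex.mul_re, Complex.mul_im, Complex.ofReal_re, Complex.ofReal_im,
    Complex.I_re, Complex.I_im, Complex.neg_re, Complex.neg_im]
  congr 2 <;> ring

lemma omega_pos {ε : ℝ} (hα : ∀ j, 0 < ε + (μ j).re) : 0 < omega μ ε :=
  Finset.prod_pos fun j _ => Real.sqrt_pos.2 (mul_pos (rad_pos (hα j)) (hα j))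

lemma norm_line_pow {ε : ℝ} (hε : 0 < ε) (l : ℕ) (y : ℝ) :
    ‖((ε : ℂ) + y * Complex.I) ^ l‖⁻¹ = (ε ^ l)⁻¹ * (1 + y ^ 2 / ε ^ 2) ^ (-((l : ℝ) / 2)) := by
  have h1 : ‖(ε : ℂ) + y * Complex.I‖ = ε * √(1 + y ^ 2 / ε ^ 2) := by
    rw [Complex.norm_add_mul_I]
    have : ε ^ 2 + y ^ 2 = ε ^ 2 * (1 + y ^ 2 / ε ^ 2) := by field_simp
    rw [this, Real.sqrt_mul (by positivity), Real.sqrt_sq hε.le]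
  rw [norm_pow, h1, mul_pow, mul_inv, Real.rpow_neg (by positivity), Real.sqrt_eq_rpow,
    ← Real.rpow_mul_natCast (by positivity)]
  congr 3
  ring

/-- The determinant bound is the case of all weights `1`; the bases are at least `1`, so smaller
weights only weaken it. -/
lemma inv_norm_pow_mul_inv_norm_det_le (hμ : IsEigenvalueList H k₁ μ) {ε : ℝ} (hε : 0 < ε)
    (hα : ∀ j, 0 < ε + (μ j).re) {p : Fin k → ℝ} (hp : ∀ j, p j ≤ 1) (l : ℕ) (y : ℝ) :
    ‖((ε : ℂ) + y * Complex.I) ^ l‖⁻¹ * ‖(shifted H (ε + y * Complex.I)).det‖⁻¹ ≤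
      (ε ^ l * omega μ ε)⁻¹ * kernel ε l (rad μ ε) p y := by
  have hr : ∀ j, 0 < rad μ ε j := fun j => rad_pos (hα j)
  have hω := omega_pos hα
  have hprod : 0 < ∏ j, √(1 + y ^ 2 / rad μ ε j ^ 2) :=
    Finset.prod_pos fun j _ => by positivity
  have h1 : ‖(shifted H (ε + y * Complex.I)).det‖⁻¹ ≤
      (omega μ ε)⁻¹ * ∏ j, (1 + y ^ 2 / rad μ ε j ^ 2) ^ (-(p j / 2)) := by
    calc ‖(shifted H (ε + y * Complex.I)).det‖⁻¹
        ≤ (omega μ ε * ∏ j, √(1 + y ^ 2 / rad μ ε j ^ 2))⁻¹ :=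
          inv_anti₀ (mul_pos hω hprod) (omega_mul_prod_le_norm_det hμ hα y)
      _ = (omega μ ε)⁻¹ * ∏ j, (√(1 + y ^ 2 / rad μ ε j ^ 2))⁻¹ := by
          rw [mul_inv, Finset.prod_inv_distrib]
      _ ≤ _ := by
          refine mul_le_mul_of_nonneg_left ?_ (by positivity)
          refine Finset.prod_le_prod (fun j _ => by positivity) fun j _ => ?_
          rw [Real.sqrt_eq_rpow, ← Real.rpow_neg (by positivity)]
          apply Real.rpow_le_rpow_of_exponent_le
          · exact le_add_of_nonneg_right (by positivity)
          · linarith [hp j]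
  rw [norm_line_pow hε, kernel, mul_inv, mul_assoc, mul_assoc]
  refine mul_le_mul_of_nonneg_left ?_ (by positivity)
  rw [mul_left_comm]
  exact mul_le_mul_of_nonneg_left h1 (by positivity)

/-- The weights of the eigenvalues: `1` for the real ones and `1 / 2` for the others. -/
def weight (k k₁ : ℕ) (j : Fin k) : ℝ := if j.val < k₁ then 1 else 1 / 2

lemma sum_weight_mul (k k₁ : ℕ) (f : Fin k → ℝ) :
    ∑ j, weight k k₁ j * f j =
      (∑ j : Fin k with j.val < k₁, f j) + 1 / 2 * ∑ j : Fin k with k₁ ≤ j.val, f j := by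
  rw [← Finset.sum_filter_add_sum_filter_not Finset.univ (fun j : Fin k => j.val < k₁),
    Finset.mul_sum]
  simp only [not_lt]
  congr 1
  · refine Finset.sum_congr rfl fun j hj => ?_
    rw [weight, if_pos (Finset.mem_filter.1 hj).2, one_mul]
  · refine Finset.sum_congr rfl fun j hj => ?_
    rw [weight, if_neg (not_lt.2 (Finset.mem_filter.1 hj).2)]

lemma sum_weight {k k₁ : ℕ} (h : k₁ ≤ k) :
    ∑ j, weight k k₁ j = 2 * (((k : ℝ) + k₁) / 4) := by
  have h1 := sum_weight_mul k k₁ (fun _ => 1)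
  have h2 : (Finset.univ.filter fun j : Fin k => j.val < k₁).card = k₁ := by
    rw [Fin.card_filter_val_lt, min_eq_right h]
  have h3 : (Finset.univ.filter fun j : Fin k => k₁ ≤ j.val).card = k - k₁ := by
    have := Finset.card_filter_add_card_filter_not (s := (Finset.univ : Finset (Fin k)))
      (fun j : Fin k => j.val < k₁)
    simp only [not_lt, Finset.card_univ, Fintype.card_fin] at this
    omega
  simp only [mul_one, Finset.sum_const, h2, h3, nsmul_eq_mul, Nat.cast_sub h] at h1
  rw [h1]
  ring

lemma sum_weight_div (k k₁ : ℕ) (l : ℕ) (ε Y : ℝ) (r : Fin k → ℝ) :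
    (l : ℝ) / (2 * (ε ^ 2 + Y ^ 2)) + ∑ j, weight k k₁ j / (2 * (r j ^ 2 + Y ^ 2)) =
    (l : ℝ) / (2 * (ε ^ 2 + Y ^ 2))
      + 1 / 2 * ∑ j : Fin k with j.val < k₁, 1 / (r j ^ 2 + Y ^ 2)
      + 1 / 4 * ∑ j : Fin k with k₁ ≤ j.val, 1 / (r j ^ 2 + Y ^ 2) := by
  have h := sum_weight_mul k k₁ (fun j => 1 / (r j ^ 2 + Y ^ 2))
  have h1 : ∑ j, weight k k₁ j / (2 * (r j ^ 2 + Y ^ 2)) =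
      1 / 2 * ∑ j, weight k k₁ j * (1 / (r j ^ 2 + Y ^ 2)) := by
    rw [Finset.mul_sum]
    refine Finset.sum_congr rfl fun j _ => ?_
    rw [div_eq_mul_inv, mul_inv]
    ring
  rw [h1, h]
  ring

lemma weight_nonneg (k k₁ : ℕ) (j : Fin k) : 0 ≤ weight k k₁ j := by
  unfold weight
  split_ifs <;> norm_num

lemma weight_le_one (k k₁ : ℕ) (j : Fin k) : weight k k₁ j ≤ 1 := by
  unfold weight
  split_ifs <;> norm_num

lemma rad_le_radMax (μ : Fin k → ℂ) (ε : ℝ) (j : Fin k) : rad μ ε j ≤ radMax μ ε :=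
  le_ciSup (Set.finite_range _).bddAbove j

lemma add_re_le_rad (μ : Fin k → ℂ) (ε : ℝ) (j : Fin k) : ε + (μ j).re ≤ rad μ ε j :=
  Real.le_sqrt_of_sq_le (le_add_of_nonneg_right (sq_nonneg _))

/-- The integral of the kernel is controlled by the constant `C_k`. -/
lemma integral_kernel_le_bigC {ε : ℝ} (hε : 0 < ε) (hre : ∀ j, 0 ≤ (μ j).re) (l : ℕ)
    (hk₁ : k₁ ≤ k) (hk : 4 ≤ k + k₁) :
    MeasureTheory.Integrable (kernel ε l (rad μ ε) (weight k k₁)) ∧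
    ∫ y, kernel ε l (rad μ ε) (weight k k₁) y ≤ 2 * bigC μ k₁ l ε := by
  have hr : ∀ j, 0 < rad μ ε j := fun j => rad_pos (by linarith [hre j])
  have hεR : ε ≤ radMax μ ε := by
    -- An index exists because `4 ≤ k + k₁ ≤ 2k`.
    have j : Fin k := ⟨0, by omega⟩
    linarith [add_re_le_rad μ ε j, rad_le_radMax μ ε j, hre j]
  have hm1 : 1 ≤ ((k : ℝ) + k₁) / 4 := by
    have : (4 : ℝ) ≤ k + k₁ := by exact_mod_cast hk
    linarith
  refine ⟨integrable_kernel hε l hr (rad_le_radMax μ ε) (weight_nonneg k k₁) (sum_weight hk₁) hm1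
    (hε.trans_le hεR), ?_⟩
  refine integral_kernel_le hε hεR l hr (rad_le_radMax μ ε) (weight_nonneg k k₁)
    (sum_weight hk₁) hm1 (s₁ := S₁ μ k₁ l ε) (s₂ := S₂ μ k₁ l ε) ?_ ?_
  · rw [sum_weight_div, S₁]
    ring
  · rw [sum_weight_div, S₂]

end Spectrum

/-! ### From the numerical range to accretivity -/

section NumericalRange

/-- As `ϑ ≤ π/2`, the sector lies in `Re z ≥ a`, and real vectors give real Rayleigh quotients. -/
lemma accretive_of_numericalRange_subset {n : ℕ} {A : Matrix (Fin n) (Fin n) ℝ} {a ϑ : ℝ}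
    (hϑ : ϑ ≤ Real.pi / 2)
    (hW : numericalRange (A.map (fun x : ℝ => (x : ℂ))) ⊆ sector ϑ a)
    (x : EuclideanSpace ℝ (Fin n)) : a * ‖x‖ ^ 2 ≤ inner ℝ x (act A x) := by
  rcases eq_or_ne x 0 with rfl | hx
  · simp
  have hx0 : 0 < ‖x‖ ^ 2 := by
    have := norm_pos_iff.2 hx
    positivity
  have h1 (y : EuclideanSpace ℝ (Fin n)) :
      star (cplx n x).ofLp ⬝ᵥ (cplx n y).ofLp = ((inner ℝ x y : ℝ) : ℂ) := by
    rw [← inner_cplx, EuclideanSpace.inner_eq_star_dotProduct, dotProduct_comm]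
  have hne : (cplx n x).ofLp ≠ 0 := by
    intro h
    apply hx
    ext i
    have := congrFun h i
    simpa [cplx_apply] using this
  have h2 := hW ⟨(cplx n x).ofLp, hne, rfl⟩
  rw [← ofLp_cact, cact_cplx, h1, h1, real_inner_self_eq_norm_sq] at h2
  have h3 := Complex.abs_arg_le_pi_div_two_iff.1 (le_trans h2 hϑ)
  rw [← Complex.ofReal_div, ← Complex.ofReal_sub, Complex.ofReal_re, sub_nonneg,
    le_div_iff₀ hx0] at h3
  exact h3

end NumericalRange

/-! ### Arnoldi relation and residual -/

section ArnoldiProcess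

variable {n : ℕ} (A : Matrix (Fin n) (Fin n) ℝ) (v : EuclideanSpace ℝ (Fin n))

lemma arnoldiVec_zero : arnoldiVec A v 0 = ‖v‖⁻¹ • v := by
  rw [arnoldiVec]

lemma arnoldiVec_succ (j : ℕ) :
    arnoldiVec A v (j + 1) = ‖arnoldiRemainder A v j‖⁻¹ • arnoldiRemainder A v j := by
  rw [arnoldiVec, arnoldiRemainder, Finset.sum_range]

/-- Holds at a breakdown too: with `0⁻¹ = 0` both sides vanish. -/
lemma norm_smul_arnoldiVec_succ (j : ℕ) :
    ‖arnoldiRemainder A v j‖ • arnoldiVec A v (j + 1) = arnoldiRemainder A v j := by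
  rw [arnoldiVec_succ]
  rcases eq_or_ne (arnoldiRemainder A v j) 0 with h | h
  · simp [h]
  · rw [smul_smul, mul_inv_cancel₀ (norm_ne_zero_iff.2 h), one_smul]

lemma arnoldiCoeff_succ (j : ℕ) : arnoldiCoeff A v (j + 1) j = ‖arnoldiRemainder A v j‖ := by
  simp [arnoldiCoeff]

lemma arnoldiCoeff_eq_zero {i j : ℕ} (h : j + 1 < i) : arnoldiCoeff A v i j = 0 := by
  rw [arnoldiCoeff, if_neg (by omega), if_neg (by omega)]

variable {A v}

lemma inner_arnoldiRemainder {j : ℕ}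
    (horth : ∀ i i', i ≤ j → i' ≤ j →
      inner ℝ (arnoldiVec A v i) (arnoldiVec A v i') = if i = i' then (1 : ℝ) else 0)
    {i : ℕ} (hi : i ≤ j) : inner ℝ (arnoldiVec A v i) (arnoldiRemainder A v j) = 0 := by
  rw [arnoldiRemainder, inner_sub_right, inner_sum, Finset.sum_eq_single i]
  · rw [inner_smul_right, horth i i hi hi, if_pos rfl, mul_one, sub_self]
  · intro i' hi' hne
    rw [inner_smul_right, horth i i' hi (by simpa [Nat.lt_succ_iff] using hi'), if_neg hne.symm,
      mul_zero]
  · intro h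
    exact absurd (Finset.mem_range.2 (Nat.lt_succ_of_le hi)) h

lemma inner_arnoldiVec (hv : v ≠ 0) {k : ℕ}
    (hA : ∀ j : ℕ, j + 1 < k → arnoldiCoeff A v (j + 1) j ≠ 0) (j : ℕ) (hj : j < k) :
    ∀ i i', i ≤ j → i' ≤ j →
      inner ℝ (arnoldiVec A v i) (arnoldiVec A v i') = if i = i' then (1 : ℝ) else 0 := by
  induction j with
  | zero =>
    intro i i' hi hi'
    obtain rfl : i = 0 := by omega
    obtain rfl : i' = 0 := by omega
    have : ‖v‖ ≠ 0 := norm_ne_zero_iff.2 hv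
    rw [if_pos rfl, real_inner_self_eq_norm_sq, arnoldiVec_zero, norm_smul, norm_inv, norm_norm,
      inv_mul_cancel₀ this, one_pow]
  | succ j ih =>
    have ih := ih (by omega)
    have hnew (i : ℕ) (hi : i ≤ j) :
        inner ℝ (arnoldiVec A v i) (arnoldiVec A v (j + 1)) = (0 : ℝ) := by
      rw [arnoldiVec_succ, inner_smul_right, inner_arnoldiRemainder ih hi, mul_zero]
    have hself : inner ℝ (arnoldiVec A v (j + 1)) (arnoldiVec A v (j + 1)) = (1 : ℝ) := by
      have := hA j hj
      rw [arnoldiCoeff_succ] at this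
      rw [real_inner_self_eq_norm_sq, arnoldiVec_succ, norm_smul, norm_inv, norm_norm,
        inv_mul_cancel₀ this, one_pow]
    intro i i' hi hi'
    rcases Nat.lt_or_ge j i with h | h <;> rcases Nat.lt_or_ge j i' with h' | h'
    · obtain rfl : i = j + 1 := by omega
      obtain rfl : i' = j + 1 := by omega
      rw [if_pos rfl, hself]
    · obtain rfl : i = j + 1 := by omega
      rw [real_inner_comm, hnew i' h', if_neg (by omega)]
    · obtain rfl : i' = j + 1 := by omega
      rw [hnew i h, if_neg (by omega)]
    · exact ih i i' h h'

lemma act_arnoldiV (k : ℕ) (x : EuclideanSpace ℝ (Fin k)) :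
    act (arnoldiV A v k) x = ∑ j : Fin k, x j • arnoldiVec A v j := by
  ext i
  simp [act, arnoldiV, Matrix.mulVec, dotProduct, mul_comm]

lemma inner_act_arnoldiV (hv : v ≠ 0) {k : ℕ}
    (hA : ∀ j : ℕ, j + 1 < k → arnoldiCoeff A v (j + 1) j ≠ 0) (x y : EuclideanSpace ℝ (Fin k)) :
    inner ℝ (act (arnoldiV A v k) x) (act (arnoldiV A v k) y) = inner ℝ x y := by
  rw [act_arnoldiV, act_arnoldiV, sum_inner, PiLp.inner_apply]
  refine Finset.sum_congr rfl fun i _ => ?_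
  rw [inner_sum, Finset.sum_eq_single i]
  · rw [inner_smul_left, inner_smul_right, inner_arnoldiVec hv hA i i.isLt i i le_rfl le_rfl]
    simp [mul_comm]
  · intro j _ hne
    rw [inner_smul_left, inner_smul_right, inner_arnoldiVec hv hA (max i j)
      (max_lt i.isLt j.isLt) i j (le_max_left _ _) (le_max_right _ _), if_neg]
    · simp
    · exact fun h => hne (Fin.ext h.symm)
  · intro h
    exact absurd (Finset.mem_univ i) h

lemma act_arnoldiV_unitFirst (hv : v ≠ 0) (m : ℕ) :
    act (arnoldiV A v (m + 1)) (‖v‖ • unitFirst (m + 1)) = v := by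
  have : ‖v‖ ≠ 0 := norm_ne_zero_iff.2 hv
  rw [act_smul, act_arnoldiV, Fin.sum_univ_succ]
  simp [unitFirst, arnoldiVec_zero, smul_smul, this]

lemma inner_unitLast (m : ℕ) (x : EuclideanSpace ℝ (Fin (m + 1))) :
    inner ℝ (unitLast (m + 1)) x = x (Fin.last m) := by
  rw [PiLp.inner_apply, Finset.sum_eq_single (Fin.last m)]
  · simp [unitLast]
  · intro j _ hne
    have : j.val ≠ m := fun h => hne (Fin.ext h)
    simp [unitLast, this]
  · simp

/-- For `j < m` the index `j + 1` is still within range, so the remainder is absorbed as the term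
`h_{j+1,j} v_{j+1}`; only the column `m` leaves a remainder. -/
lemma act_arnoldiVec_of_lt {m : ℕ} {j : ℕ} (hj : j < m) :
    act A (arnoldiVec A v j) =
      ∑ i ∈ Finset.range (m + 1), arnoldiCoeff A v i j • arnoldiVec A v i := by
  have h1 : ∑ i ∈ Finset.range (m + 1), arnoldiCoeff A v i j • arnoldiVec A v i =
      ∑ i ∈ Finset.range (j + 2), arnoldiCoeff A v i j • arnoldiVec A v i := by
    symm
    refine Finset.sum_subset (Finset.range_subset_range.2 (by omega)) fun i _ hi => ?_
    rw [Finset.mem_range] at hi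
    rw [arnoldiCoeff_eq_zero A v (by omega), zero_smul]
  rw [h1, Finset.sum_range_succ, arnoldiCoeff_succ, norm_smul_arnoldiVec_succ, arnoldiRemainder]
  have h2 : ∑ i ∈ Finset.range (j + 1), arnoldiCoeff A v i j • arnoldiVec A v i =
      ∑ i ∈ Finset.range (j + 1),
        (inner ℝ (arnoldiVec A v i) (act A (arnoldiVec A v j)) : ℝ) • arnoldiVec A v i := by
    refine Finset.sum_congr rfl fun i hi => ?_
    rw [Finset.mem_range] at hi
    rw [arnoldiCoeff, if_pos (by omega)]
  rw [h2]
  abel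

lemma act_arnoldiVec_last (m : ℕ) :
    act A (arnoldiVec A v m) =
      (∑ i ∈ Finset.range (m + 1), arnoldiCoeff A v i m • arnoldiVec A v i)
        + arnoldiRemainder A v m := by
  have h2 : ∑ i ∈ Finset.range (m + 1), arnoldiCoeff A v i m • arnoldiVec A v i =
      ∑ i ∈ Finset.range (m + 1),
        (inner ℝ (arnoldiVec A v i) (act A (arnoldiVec A v m)) : ℝ) • arnoldiVec A v i := by
    refine Finset.sum_congr rfl fun i hi => ?_
    rw [Finset.mem_range] at hi
    rw [arnoldiCoeff, if_pos (by omega)]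
  rw [h2, arnoldiRemainder]
  abel

/-- The Arnoldi relation `A V = V H + w e_kᵀ`. -/
lemma arnoldi_relation (m : ℕ) (x : EuclideanSpace ℝ (Fin (m + 1))) :
    act A (act (arnoldiV A v (m + 1)) x) =
      act (arnoldiV A v (m + 1)) (act (arnoldiH A v (m + 1)) x)
        + x (Fin.last m) • arnoldiRemainder A v m := by
  have hVH : act (arnoldiV A v (m + 1)) (act (arnoldiH A v (m + 1)) x) =
      ∑ j : Fin (m + 1), x j •
        ∑ i ∈ Finset.range (m + 1), arnoldiCoeff A v i j • arnoldiVec A v i := by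
    rw [act_arnoldiV]
    simp only [act, Matrix.mulVec, dotProduct, arnoldiH, Matrix.of_apply, Finset.sum_smul,
      Finset.smul_sum, Finset.sum_range, smul_smul]
    rw [Finset.sum_comm]
    refine Finset.sum_congr rfl fun j _ => Finset.sum_congr rfl fun i _ => ?_
    rw [mul_comm]
  have hAV : act A (act (arnoldiV A v (m + 1)) x) =
      ∑ j : Fin (m + 1), x j • act A (arnoldiVec A v j) := by
    rw [act_arnoldiV, ← actCLM_apply, map_sum]
    simp only [map_smul, actCLM_apply]
  rw [hVH, hAV, Fin.sum_univ_castSucc, Fin.sum_univ_castSucc, Fin.val_last, act_arnoldiVec_last,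
    smul_add, ← add_assoc]
  congr 2
  refine Finset.sum_congr rfl fun j _ => ?_
  rw [Fin.val_castSucc, act_arnoldiVec_of_lt j.isLt]

/-- `V` is an isometry and the remainder is orthogonal to its range, so `⟨x, Hx⟩ = ⟨Vx, AVx⟩`. -/
lemma accretive_arnoldiH (hv : v ≠ 0) {m : ℕ}
    (hA : ∀ j : ℕ, j + 1 < m + 1 → arnoldiCoeff A v (j + 1) j ≠ 0) {a : ℝ}
    (hacc : ∀ x : EuclideanSpace ℝ (Fin n), a * ‖x‖ ^ 2 ≤ inner ℝ x (act A x))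
    (x : EuclideanSpace ℝ (Fin (m + 1))) :
    a * ‖x‖ ^ 2 ≤ inner ℝ x (act (arnoldiH A v (m + 1)) x) := by
  have h1 := hacc (act (arnoldiV A v (m + 1)) x)
  have h2 : inner ℝ (act (arnoldiV A v (m + 1)) x) (arnoldiRemainder A v m) = (0 : ℝ) := by
    rw [act_arnoldiV, sum_inner]
    refine Finset.sum_eq_zero fun j _ => ?_
    rw [inner_smul_left, inner_arnoldiRemainder (inner_arnoldiVec hv hA m (Nat.lt_succ_self m))
      (Nat.lt_succ_iff.1 j.isLt), mul_zero]
  rw [arnoldi_relation, inner_add_right, inner_smul_right, h2, mul_zero, add_zero,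
    inner_act_arnoldiV hv hA, ← real_inner_self_eq_norm_sq, inner_act_arnoldiV hv hA,
    real_inner_self_eq_norm_sq] at h1
  exact h1

/-- `V φ_ℓ(-tH) β e_1` solves the projected equation exactly, so only the defect of the Arnoldi
relation survives. -/
lemma residual_eq (hv : v ≠ 0) (l m : ℕ) {t : ℝ} (ht : 0 < t) :
    residual A v l (m + 1) t =
      (-(‖v‖ * phiCorner A v l (m + 1) t)) • arnoldiRemainder A v m := by
  set H := arnoldiH A v (m + 1) with hH
  set V := arnoldiV A v (m + 1) with hV
  set x := ‖v‖ • unitFirst (m + 1) with hx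
  have hVx : act V x = v := act_arnoldiV_unitFirst hv m
  have happrox (s : ℝ) (hs : 0 < s) :
      approx A v l (m + 1) s = (s ^ l)⁻¹ • act V (act (flow l H s) x) := by
    rw [flow, smul_act, act_smul, smul_smul, inv_mul_cancel₀ (pow_ne_zero _ hs.ne'), one_smul]
    rfl
  have happ : approx A v l (m + 1) t = act V (act (phi l ((-t) • H)) x) := rfl
  clear_value x
  have hu : HasDerivAt (fun s => act V (act (flow l H s) x))
      (act V (-(act H (act (flow l H t) x)) + flowSource l t • x)) t :=
    (actCLM V).hasFDerivAt.comp_hasDerivAt t (hasDerivAt_act_flow l H x t)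
  -- Differentiating `s^(-l)` produces the `l/t` term that the residual cancels.
  have hpow : HasDerivAt (fun s : ℝ => (s ^ l)⁻¹) (-((l : ℝ) / t) * (t ^ l)⁻¹) t := by
    refine ((hasDerivAt_pow l t).inv (pow_ne_zero _ ht.ne')).congr_deriv ?_
    cases l with
    | zero => simp
    | succ l =>
      rw [Nat.add_sub_cancel]
      field_simp
      ring
  have hd : HasDerivAt (approx A v l (m + 1))
      ((t ^ l)⁻¹ • act V (-(act H (act (flow l H t) x)) + flowSource l t • x)
        + (-((l : ℝ) / t) * (t ^ l)⁻¹) • act V (act (flow l H t) x)) t := by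
    refine (hpow.smul hu).congr_of_eventuallyEq ?_
    filter_upwards [Ioi_mem_nhds ht] with s hs
    exact happrox s hs
  have hphi : (t ^ l)⁻¹ • act (flow l H t) x = act (phi l ((-t) • H)) x := by
    rw [flow, smul_act, smul_smul, inv_mul_cancel₀ (pow_ne_zero _ ht.ne'), one_smul]
  have hd' : deriv (approx A v l (m + 1)) t =
      -(act V (act H (act (phi l ((-t) • H)) x))) + ((t ^ l)⁻¹ * flowSource l t) • v
        - ((l : ℝ) / t) • approx A v l (m + 1) t := by
    rw [hd.deriv, happrox t ht, ← hphi, act_add, act_smul V (flowSource l t), hVx, act_neg,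
      act_smul, act_smul, smul_add, smul_neg, smul_smul, smul_smul, neg_mul, neg_smul,
      sub_eq_add_neg]
  have hlast : (act (phi l ((-t) • H)) x) (Fin.last m) = ‖v‖ * phiCorner A v l (m + 1) t := by
    rw [phiCorner, inner_unitLast, hx, act_smul]
    rfl
  have hAV : act A (approx A v l (m + 1) t) = act V (act H (act (phi l ((-t) • H)) x))
      + (‖v‖ * phiCorner A v l (m + 1) t) • arnoldiRemainder A v m := by
    rw [← hlast, happ]
    exact arnoldi_relation m _
  generalize ‖v‖ * phiCorner A v l (m + 1) t = c at hAV
  cases l with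
  | zero =>
    rw [residual, hd', hAV, flowSource]
    simp only [mul_zero, zero_smul, Nat.cast_zero, zero_div, add_zero, sub_zero, neg_smul]
    abel
  | succ l =>
    have hsrc : (t ^ (l + 1))⁻¹ * flowSource (l + 1) t = 1 / (t * (l.factorial : ℝ)) := by
      rw [flowSource]
      field_simp
      ring
    rw [residual, hd', hAV, hsrc, neg_smul c]
    abel

end ArnoldiProcess

/-! ### Error equation, its transform and the final bound -/

section ErrorBound

variable {n : ℕ} {A : Matrix (Fin n) (Fin n) ℝ} {v : EuclideanSpace ℝ (Fin n)}

/-- The scaled error `t ^ ℓ e_{ℓ,k}(t)`. -/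
def scaledErr (A : Matrix (Fin n) (Fin n) ℝ) (v : EuclideanSpace ℝ (Fin n)) (l k : ℕ) (t : ℝ) :
    EuclideanSpace ℝ (Fin n) :=
  act (flow l A t) v
    - act (arnoldiV A v k) (act (flow l (arnoldiH A v k) t) (‖v‖ • unitFirst k))

lemma scaledErr_eq (l k : ℕ) (t : ℝ) : scaledErr A v l k t = t ^ l • err A v l k t := by
  rw [scaledErr, flow, flow, smul_act, smul_act, act_smul, ← smul_sub]
  rfl

lemma scaledErr_zero (hv : v ≠ 0) (l m : ℕ) : scaledErr A v l (m + 1) 0 = 0 := by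
  cases l with
  | zero =>
    rw [scaledErr, flow_zero_zero, flow_zero_zero, act_one, act_one, act_arnoldiV_unitFirst hv,
      sub_self]
  | succ l =>
    rw [scaledErr, flow_succ_zero, flow_succ_zero]
    simp [act]

/-- The sources of the two flows cancel because `V β e_1 = v`; the Arnoldi relation leaves only the
remainder term. -/
lemma hasDerivAt_scaledErr (hv : v ≠ 0) (l m : ℕ) (t : ℝ) :
    HasDerivAt (scaledErr A v l (m + 1))
      (-(act A (scaledErr A v l (m + 1) t)) -
        (act (flow l (arnoldiH A v (m + 1)) t) (‖v‖ • unitFirst (m + 1))) (Fin.last m) •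
          arnoldiRemainder A v m) t := by
  have h1 := hasDerivAt_act_flow l A v t
  have h2 : HasDerivAt (fun s => act (arnoldiV A v (m + 1))
      (act (flow l (arnoldiH A v (m + 1)) s) (‖v‖ • unitFirst (m + 1)))) _ t :=
    (actCLM (arnoldiV A v (m + 1))).hasFDerivAt.comp_hasDerivAt t
      (hasDerivAt_act_flow l (arnoldiH A v (m + 1)) (‖v‖ • unitFirst (m + 1)) t)
  refine (h1.sub h2).congr_deriv ?_
  rw [actCLM_apply, act_add, act_neg, act_smul _ (flowSource l t), act_arnoldiV_unitFirst hv,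
    scaledErr, act_sub, arnoldi_relation]
  abel

/-- Cramer's rule for `(z + H) û = z^(-l) β e_1`; the shift `z` does not touch the subdiagonal. -/
lemma det_mul_norm_laplace_flow_last (hv : v ≠ 0) {m : ℕ}
    (hA : ∀ j : ℕ, j + 1 < m + 1 → arnoldiCoeff A v (j + 1) j ≠ 0)
    (hacc : ∀ x : EuclideanSpace ℝ (Fin n), 0 ≤ inner ℝ x (act A x)) (l : ℕ) {z : ℂ}
    (hz : 0 < z.re) :
    ‖(shifted (arnoldiH A v (m + 1)) z).det‖ *
      ‖laplace (fun t => cplx (m + 1)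
        (act (flow l (arnoldiH A v (m + 1)) t) (‖v‖ • unitFirst (m + 1)))) z (Fin.last m)‖ =
      ‖z ^ l‖⁻¹ * ‖v‖ * ∏ j ∈ Finset.range m, arnoldiCoeff A v (j + 1) j := by
  have hH (x : EuclideanSpace ℝ (Fin (m + 1))) :
      0 ≤ inner ℝ x (act (arnoldiH A v (m + 1)) x) := by
    simpa using accretive_arnoldiH (a := 0) hv hA (by simpa using hacc) x
  have h := laplace_flow hH (‖v‖ • unitFirst (m + 1)) l hz
  set G := laplace (fun t => cplx (m + 1)
        (act (flow l (arnoldiH A v (m + 1)) t) (‖v‖ • unitFirst (m + 1)))) z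
  have h1 : shifted (arnoldiH A v (m + 1)) z *ᵥ G.ofLp = Pi.single 0 ((z ^ l)⁻¹ * (‖v‖ : ℂ)) := by
    have h2 := congrArg WithLp.ofLp h
    rw [WithLp.ofLp_add, WithLp.ofLp_smul, ofLp_cact, WithLp.ofLp_smul] at h2
    rw [shifted, Matrix.add_mulVec, Matrix.smul_mulVec, Matrix.one_mulVec, h2]
    ext i
    rcases eq_or_ne i 0 with rfl | hi
    · simp [cplx_apply, unitFirst]
    · have : i.val ≠ 0 := fun h => hi (Fin.ext h)
      simp [cplx_apply, unitFirst, hi]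
  rw [norm_det_mul_norm_last_of_hessenberg _ h1, norm_mul, norm_inv, Complex.norm_real, norm_norm,
    Finset.prod_range]
  · congr 1
    refine Finset.prod_congr rfl fun j _ => ?_
    have hne : j.succ ≠ j.castSucc := (Fin.castSucc_lt_succ).ne'
    simp [shifted, arnoldiH, hne, arnoldiCoeff_succ]
  · intro i j hij
    have hne : i ≠ j := by
      rintro rfl
      omega
    simp [shifted, arnoldiH, hne, arnoldiCoeff_eq_zero A v hij]

lemma continuous_cplx_act_flow {k : ℕ} (M : Matrix (Fin k) (Fin k) ℝ)
    (x : EuclideanSpace ℝ (Fin k)) (l : ℕ) : Continuous (fun t => cplx k (act (flow l M t) x)) :=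
  continuous_iff_continuousAt.2 fun t =>
    (hasDerivAt_cplx (hasDerivAt_act_flow l M x t)).continuousAt

lemma subExp_scaledErr (hv : v ≠ 0) {m : ℕ}
    (hA : ∀ j : ℕ, j + 1 < m + 1 → arnoldiCoeff A v (j + 1) j ≠ 0)
    (hacc : ∀ x : EuclideanSpace ℝ (Fin n), 0 ≤ inner ℝ x (act A x)) (l : ℕ) :
    SubExp (fun t => cplx n (scaledErr A v l (m + 1) t)) := by
  have hH (x : EuclideanSpace ℝ (Fin (m + 1))) :
      0 ≤ inner ℝ x (act (arnoldiH A v (m + 1)) x) := by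
    simpa using accretive_arnoldiH (a := 0) hv hA (by simpa using hacc) x
  refine SubExp.of_pow_bound (C := ‖v‖ + ‖‖v‖ • unitFirst (m + 1)‖) (m := l) fun t ht => ?_
  rw [norm_cplx, scaledErr, add_mul]
  refine (norm_sub_le _ _).trans (add_le_add (norm_act_flow_le hacc v l ht) ?_)
  have hiso (x : EuclideanSpace ℝ (Fin (m + 1))) : ‖act (arnoldiV A v (m + 1)) x‖ = ‖x‖ := by
    rw [← sq_eq_sq₀ (norm_nonneg _) (norm_nonneg _), ← real_inner_self_eq_norm_sq,
      ← real_inner_self_eq_norm_sq, inner_act_arnoldiV hv hA]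
  rw [hiso]
  exact norm_act_flow_le hH _ l ht

/-- The zero initial value leaves `(z + A) Ê = -ĝ(z) w`, to which the resolvent bound applies. -/
lemma norm_laplace_scaledErr_le (hv : v ≠ 0) {m : ℕ}
    (hA : ∀ j : ℕ, j + 1 < m + 1 → arnoldiCoeff A v (j + 1) j ≠ 0) {a : ℝ} (ha : 0 ≤ a)
    (hacc : ∀ x : EuclideanSpace ℝ (Fin n), a * ‖x‖ ^ 2 ≤ inner ℝ x (act A x)) (l : ℕ) {z : ℂ}
    (hz : 0 < z.re) :
    (z.re + a) * ‖laplace (fun t => cplx n (scaledErr A v l (m + 1) t)) z‖ ≤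
      ‖laplace (fun t => cplx (m + 1)
        (act (flow l (arnoldiH A v (m + 1)) t) (‖v‖ • unitFirst (m + 1)))) z (Fin.last m)‖ *
      ‖arnoldiRemainder A v m‖ := by
  have hacc0 (x : EuclideanSpace ℝ (Fin n)) : 0 ≤ inner ℝ x (act A x) :=
    (by positivity : 0 ≤ a * ‖x‖ ^ 2).trans (hacc x)
  have hH (x : EuclideanSpace ℝ (Fin (m + 1))) :
      0 ≤ inner ℝ x (act (arnoldiH A v (m + 1)) x) := by
    simpa using accretive_arnoldiH (a := 0) hv hA (by simpa using hacc0) x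
  set u : ℝ → EuclideanSpace ℂ (Fin (m + 1)) := fun t => cplx (m + 1)
        (act (flow l (arnoldiH A v (m + 1)) t) (‖v‖ • unitFirst (m + 1))) with hu
  let S : EuclideanSpace ℂ (Fin (m + 1)) →L[ℂ] EuclideanSpace ℂ (Fin n) :=
    -((EuclideanSpace.proj (𝕜 := ℂ) (Fin.last m)).smulRight (cplx n (arnoldiRemainder A v m)))
  have hS (x : EuclideanSpace ℂ (Fin (m + 1))) :
      S x = -(x (Fin.last m) • cplx n (arnoldiRemainder A v m)) := rfl
  have hsub : SubExp u := subExp_flow hH _ l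
  have hc : Continuous u := continuous_cplx_act_flow _ _ l
  have hd (t : ℝ) : HasDerivAt (fun t => cplx n (scaledErr A v l (m + 1) t))
      (-(cact A (cplx n (scaledErr A v l (m + 1) t))) + S (u t)) t := by
    refine (hasDerivAt_cplx (hasDerivAt_scaledErr hv l m t)).congr_deriv ?_
    rw [map_sub, map_neg, map_smul, cact_cplx, hS, sub_eq_add_neg, hu, cplx_apply,
      Complex.coe_smul]
  have h := laplace_of_ode (cact A) hd (S.continuous.comp hc) (subExp_scaledErr hv hA hacc0 l)
    (hsub.clm S) hz
  rw [scaledErr_zero hv, map_zero, zero_add, laplace_clm hc hsub S hz, hS] at h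
  have h1 := norm_smul_add_cact_ge hacc z
    (laplace (fun t => cplx n (scaledErr A v l (m + 1) t)) z)
  rwa [h, norm_neg, norm_smul, norm_cplx] at h1

lemma norm_err_le (hv : v ≠ 0) {m : ℕ}
    (hA : ∀ j : ℕ, j + 1 < m + 1 → arnoldiCoeff A v (j + 1) j ≠ 0) {a : ℝ} (ha : 0 ≤ a)
    (hacc : ∀ x : EuclideanSpace ℝ (Fin n), a * ‖x‖ ^ 2 ≤ inner ℝ x (act A x))
    {k₁ : ℕ} {μ : Fin (m + 1) → ℂ} (hμ : IsEigenvalueList (arnoldiH A v (m + 1)) k₁ μ)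
    (l : ℕ) {t ε : ℝ} (ht : 0 < t) (hε : 0 < ε) (hk : 4 ≤ m + 1 + k₁) :
    t ^ l * ‖err A v l (m + 1) t‖ ≤ Real.exp (t * ε) / Real.pi *
      (‖v‖ * (∏ j ∈ Finset.range m, arnoldiCoeff A v (j + 1) j) * ‖arnoldiRemainder A v m‖
        / ((ε + a) * (ε ^ l * omega μ ε))) * bigC μ k₁ l ε := by
  have hacc0 (x : EuclideanSpace ℝ (Fin n)) : 0 ≤ inner ℝ x (act A x) :=
    (by positivity : 0 ≤ a * ‖x‖ ^ 2).trans (hacc x)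
  have hre : ∀ j, 0 ≤ (μ j).re := fun j => by
    have hj : μ j ∈ ((arnoldiH A v (m + 1)).map (fun x : ℝ => (x : ℂ))).charpoly.roots := by
      rw [hμ.roots_eq]
      exact Multiset.mem_map_of_mem μ (Finset.mem_univ_val j)
    exact ha.trans (re_ge_of_mem_roots_charpoly (accretive_arnoldiH hv hA hacc) hj)
  have hα : ∀ j, 0 < ε + (μ j).re := fun j => by linarith [hre j]
  obtain ⟨hi, hint⟩ := integral_kernel_le_bigC hε hre l hμ.le hk
  have hprod : 0 ≤ ∏ j ∈ Finset.range m, arnoldiCoeff A v (j + 1) j :=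
    Finset.prod_nonneg fun j _ => by
      rw [arnoldiCoeff_succ]
      positivity
  have hω := omega_pos hα
  set P := ∏ j ∈ Finset.range m, arnoldiCoeff A v (j + 1) j
  set W := ‖arnoldiRemainder A v m‖
  set K := ‖v‖ * P * W / ((ε + a) * (ε ^ l * omega μ ε)) with hK
  have hK0 : 0 ≤ K := by positivity
  have hL (y : ℝ) : ‖laplace (fun t => cplx n (scaledErr A v l (m + 1) t)) (ε + y * Complex.I)‖ ≤
      K * kernel ε l (rad μ ε) (weight (m + 1) k₁) y := by
    have hz : ((ε : ℂ) + y * Complex.I).re = ε := by simp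
    have hz0 : 0 < ((ε : ℂ) + y * Complex.I).re := by rwa [hz]
    have h1 := norm_laplace_scaledErr_le hv hA ha hacc l hz0
    have h2 := det_mul_norm_laplace_flow_last hv hA hacc0 l hz0
    have h3 := inv_norm_pow_mul_inv_norm_det_le hμ hε hα (weight_le_one (m + 1) k₁) l y
    rw [hz] at h1
    have hdet : 0 < ‖(shifted (arnoldiH A v (m + 1)) (ε + y * Complex.I)).det‖ := by
      refine lt_of_lt_of_le ?_ (omega_mul_prod_le_norm_det hμ hα y)
      exact mul_pos hω (Finset.prod_pos fun j _ => by positivity)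
    rw [← eq_inv_mul_iff_mul_eq₀ hdet.ne'] at h2
    rw [h2] at h1
    have hεa : 0 < ε + a := by positivity
    rw [← le_div_iff₀' hεa] at h1
    refine h1.trans ?_
    calc _ = (‖v‖ * P * W / (ε + a)) * (‖((ε : ℂ) + y * Complex.I) ^ l‖⁻¹ *
          ‖(shifted (arnoldiH A v (m + 1)) (ε + y * Complex.I)).det‖⁻¹) := by ring
      _ ≤ (‖v‖ * P * W / (ε + a)) * ((ε ^ l * omega μ ε)⁻¹ *
          kernel ε l (rad μ ε) (weight (m + 1) k₁) y) :=
        mul_le_mul_of_nonneg_left h3 (by positivity)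
      _ = _ := by
        rw [hK, ← mul_assoc, div_mul_eq_div_div, div_eq_mul_inv _ (ε ^ l * omega μ ε)]
  have hsub := subExp_scaledErr hv hA hacc0 l
  have hc : Continuous (fun t => cplx n (scaledErr A v l (m + 1) t)) :=
    continuous_iff_continuousAt.2 fun t =>
      (hasDerivAt_cplx (hasDerivAt_scaledErr hv l m t)).continuousAt
  have hLi : MeasureTheory.Integrable (fun y : ℝ =>
      laplace (fun t => cplx n (scaledErr A v l (m + 1) t)) (ε + y * Complex.I)) :=
    (hi.const_mul K).mono' (continuous_laplace_line hc hsub hε).aestronglyMeasurable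
      (Filter.Eventually.of_forall hL)
  have h := norm_le_integral_laplace hc hsub hε ht hLi
  rw [norm_cplx, scaledErr_eq, norm_smul, norm_pow, Real.norm_of_nonneg ht.le] at h
  refine h.trans ?_
  have h4 : ∫ y : ℝ, ‖laplace (fun t => cplx n (scaledErr A v l (m + 1) t))
      (ε + y * Complex.I)‖ ≤ K * (2 * bigC μ k₁ l ε) := by
    refine (MeasureTheory.integral_mono hLi.norm (hi.const_mul K) hL).trans ?_
    rw [MeasureTheory.integral_const_mul]
    exact mul_le_mul_of_nonneg_left hint hK0
  -- The `2` from the even kernel cancels the one in the inversion factor `1/(2π)`.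
  calc _ ≤ Real.exp (t * ε) / (2 * Real.pi) * (K * (2 * bigC μ k₁ l ε)) :=
        mul_le_mul_of_nonneg_left h4 (by positivity)
    _ = _ := by
      field_simp

end ErrorBound

end PhiArnoldi

end

theorem theorem4p3 {n : ℕ} (A : Matrix (Fin n) (Fin n) ℝ) (v : EuclideanSpace ℝ (Fin n))
    (hv : v ≠ 0)
    (a ϑ : ℝ) (ha : 0 ≤ a) (hϑ₀ : 0 ≤ ϑ) (hϑ : ϑ ≤ Real.pi / 2)
    (hW : PhiArnoldi.numericalRange (A.map (fun x : ℝ => (x : ℂ))) ⊆ PhiArnoldi.sector ϑ a)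
    (k : ℕ) (hArnoldi : ∀ j : ℕ, j + 1 < k → PhiArnoldi.arnoldiCoeff A v (j + 1) j ≠ 0)
    (k₁ : ℕ) (μ : Fin k → ℂ)
    (hμ : PhiArnoldi.IsEigenvalueList (PhiArnoldi.arnoldiH A v k) k₁ μ)
    (ℓ : ℕ) (t ε : ℝ) (ht : 0 < t) (hε : 0 < ε) (hk : 4 ≤ k + k₁)
    (hcorner : PhiArnoldi.phiCorner A v ℓ k t ≠ 0) :
    ‖PhiArnoldi.err A v ℓ k t‖ ≤
      PhiArnoldi.smallC A v μ a ε ℓ t * PhiArnoldi.bigC μ k₁ ℓ ε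
        * ‖PhiArnoldi.residual A v ℓ k t‖ := by
  obtain ⟨m, rfl⟩ : ∃ m, k = m + 1 := ⟨k - 1, by have := hμ.le; omega⟩
  have hacc := PhiArnoldi.accretive_of_numericalRange_subset hϑ hW
  have h := PhiArnoldi.norm_err_le hv hArnoldi ha hacc hμ ℓ ht hε hk
  rw [mul_comm, ← le_div_iff₀ (pow_pos ht ℓ)] at h
  refine h.trans (le_of_eq ?_)
  -- The residual norm is `β |e_kᵀ φ_ℓ(-tH) e_1| ‖w‖`; the nonzero corner entry cancels the
  -- denominator in `c_{ℓ,k}`.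
  rw [PhiArnoldi.residual_eq hv ℓ m ht, norm_smul, norm_neg, norm_mul, norm_norm,
    Real.norm_eq_abs, PhiArnoldi.smallC, Nat.add_sub_cancel, mul_pow]
  have hc : |PhiArnoldi.phiCorner A v ℓ (m + 1) t| ≠ 0 := abs_ne_zero.2 hcorner
  generalize |PhiArnoldi.phiCorner A v ℓ (m + 1) t| = c at hc
  generalize PhiArnoldi.bigC μ k₁ ℓ ε = C
  generalize PhiArnoldi.omega μ ε = ω
  field_simp
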